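/- Let $\mathcal G$ be a finite connected discrete graph (loops and multiple edges are allowed) with edge set $\mathcal E$. Let $$\overline{\mathscr L_{\mathcal G}}=\Big\{\underline l\in\mathbb R^{\mathcal E}:\ \textstyle\sum_{e}l_e=1\Big\}\cap[0,\infty)^{\mathcal E}$$ be the closure of the set of all positive edge lengths with total length $1$. For $\underline l\in\overline{\mathscr L_{\mathcal G}}$ let $\Gamma(\mathcal G;\underline l)$ be the metric graph obtained from $\mathcal G$ by contracting every edge $e$ with $l_e=0$ (the edge is removed and its endpoints are identified) and identifying every other edge $e$ with the interval $[0,l_e]$. Let $k_1[\Gamma(\mathcal G;\underline l)]$ be its spectral gap, that is, the smallest $k>0$ such that $k^2$ is an eigenvalue of the operator $f\mapsto -f''$ on the functions that are $H^2$ on each edge, are continuous at every vertex, and whose outgoing derivatives sum to zero at every vertex (Neumann conditions). A supremizer of $\mathcal G$ is a graph $\Gamma(\mathcal G;\underline l^*)$ with $\underline l^*\in\overline{\mathscr L_{\mathcal G}}$ such that $k_1[\Gamma(\mathcal G;\underline l^*)]\ge k_1[\Gamma(\mathcal G;\underline l)]$ for all $\underline l\in\overline{\mathscr L_{\mathcal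 G}}$. If $\mathcal G$ is not a tree, then $\mathcal G$ has a supremizer, and no supremizer of $\mathcal G$ is a tree. -/

import Mathlib

open MeasureTheory
open scoped Graph

/-! Discrete graphs are Mathlib's multigraphs `Graph α β` (loops and parallel edges are allowed). -/

namespace QuantumGraph

variable {α β : Type*}

/-- A multigraph is connected if its vertex set is nonempty and any two vertices are joined by a
path; loops and multiplicities of edges play no role for this. -/
def IsConnected (G : Graph α β) : Prop :=
  G.toSimpleGraph.Connected

/-- A multigraph is a tree if it is connected and has no cycles: no loops and no pairs of parallel
edges (`G.Simple`), and no cycles in the resulting simple graph. -/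
def IsTree (G : Graph α β) : Prop :=
  G.Simple ∧ G.toSimpleGraph.IsTree

/-- The relation on vertices of being the two endpoints of an edge in `C`. -/
def contractRel (G : Graph α β) (C : Set β) (x y : α) : Prop :=
  ∃ e ∈ C, G.IsLink e x y

/-- The graph obtained from `G` by contracting the edges in `C`: these edges are removed, and
the endpoints of each of them are identified (`Quot` passes to the equivalence relation generated
by `contractRel`). -/
def contract (G : Graph α β) (C : Set β) : Graph (Quot (contractRel G C)) β :=
  (G.deleteEdges C).map (Quot.mk (contractRel G C))

/-- A metric graph: a discrete graph each of whose edges `e` is identified with an interval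
`[0, length e]` of positive length, such that the coordinate `0` corresponds to the vertex `start e`
and the coordinate `length e` to the vertex `finish e`. -/
structure MetricGraph (α β : Type*) where
  /-- the underlying discrete graph -/
  graph : Graph α β
  /-- the starting vertex of each edge -/
  start : E(graph) → α
  /-- the final vertex of each edge -/
  finish : E(graph) → α
  isLink : ∀ e : E(graph), graph.IsLink (e : β) (start e) (finish e)
  /-- the length of each edge -/
  length : E(graph) → ℝ
  length_pos : ∀ e, 0 < length e

/-- `f` lies in the Sobolev space `H²([0, l])` with first derivative `f'` and second (weak)
derivative `f''`: the function `f''` is square integrable, and `f'` and `f` are the (absolutely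
continuous) antiderivatives of `f''` and `f'`. Only values on `[0, l]` matter. -/
structure IsSobolevH2 (l : ℝ) (f f' f'' : ℝ → ℂ) : Prop where
  memLp : MemLp f'' 2 (volume.restrict (Set.Icc 0 l))
  eq_integral' : ∀ x ∈ Set.Icc 0 l, f' x = f' 0 + ∫ t in (0 : ℝ)..x, f'' t
  eq_integral : ∀ x ∈ Set.Icc 0 l, f x = f 0 + ∫ t in (0 : ℝ)..x, f' t

namespace MetricGraph

/-- The family `f = (f e)` of functions on the edges, with edgewise first and second derivatives
`f'` and `f''`, lies in the domain of the Neumann Laplacian: it is edgewise `H²`, continuous at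
every vertex, and the outgoing derivatives at every vertex sum up to zero
(a loop contributes both of its ends). -/
structure MemNeumannDomain (Γ : MetricGraph α β) (f f' f'' : E(Γ.graph) → ℝ → ℂ) : Prop where
  sobolev : ∀ e, IsSobolevH2 (Γ.length e) (f e) (f' e) (f'' e)
  continuous : ∃ φ : α → ℂ, ∀ e, f e 0 = φ (Γ.start e) ∧ f e (Γ.length e) = φ (Γ.finish e)
  kirchhoff : ∀ v ∈ V(Γ.graph),
    (∑ᶠ (e : E(Γ.graph)) (_ : Γ.start e = v), f' e 0) +
      (∑ᶠ (e : E(Γ.graph)) (_ : Γ.finish e = v), -f' e (Γ.length e)) = 0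

/-- `lam` is an eigenvalue of the Neumann Laplacian `f ↦ -f''`. -/
def IsEigenvalue (Γ : MetricGraph α β) (lam : ℝ) : Prop :=
  ∃ f f' f'' : E(Γ.graph) → ℝ → ℂ, Γ.MemNeumannDomain f f' f'' ∧
    (∀ e, ∀ᵐ x ∂(volume.restrict (Set.Icc 0 (Γ.length e))), -f'' e x = (lam : ℂ) * f e x) ∧
    ∃ e, ∃ x ∈ Set.Icc 0 (Γ.length e), f e x ≠ 0

/-- The spectral gap `k₁`: the least `k > 0` such that `k²` is an eigenvalue of the Neumann
Laplacian. (For a connected metric graph the eigenvalue `0` is simple, so `k₁²` is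
the second eigenvalue.) -/
noncomputable def spectralGap (Γ : MetricGraph α β) : ℝ :=
  sInf {k : ℝ | 0 < k ∧ Γ.IsEigenvalue (k ^ 2)}

end MetricGraph

/-- The space of positive edge lengths of total length one. -/
def lengths (G : Graph α β) : Set (E(G) → ℝ) :=
  {l | (∑ᶠ e, l e) = 1 ∧ ∀ e, 0 < l e}

/-- The closure of the space of lengths: some of the lengths may vanish. -/
def closedLengths (G : Graph α β) : Set (E(G) → ℝ) :=
  closure (lengths G)

theorem closedLengths_nonneg {G : Graph α β} {l : E(G) → ℝ} (hl : l ∈ closedLengths G)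
    (e : E(G)) : 0 ≤ l e := by
  have hc : IsClosed {m : E(G) → ℝ | 0 ≤ m e} :=
    isClosed_le continuous_const (continuous_apply e)
  exact closure_minimal (fun m (hm : m ∈ lengths G) => (hm.2 e).le) hc hl

/-- The set of edges of length zero. -/
def zeroEdges (G : Graph α β) (l : E(G) → ℝ) : Set β :=
  {e | ∃ h : e ∈ E(G), l ⟨e, h⟩ = 0}

theorem exists_ends (G : Graph α β) (e : E(G)) :
    ∃ p : α × α, G.IsLink (e : β) p.1 p.2 := by
  obtain ⟨x, y, h⟩ := Graph.exists_isLink_of_mem_edgeSet e.2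
  exact ⟨(x, y), h⟩

/-- An arbitrary choice of a direction for each edge. -/
noncomputable def ends (G : Graph α β) (e : E(G)) : α × α :=
  (exists_ends G e).choose

theorem ends_isLink (G : Graph α β) (e : E(G)) :
    G.IsLink (e : β) (ends G e).1 (ends G e).2 :=
  (exists_ends G e).choose_spec

/-- An edge of a contracted graph, as an edge of the original graph. -/
def origEdge {G : Graph α β} {C : Set β} (e : E(contract G C)) : E(G) :=
  ⟨e.1, e.2.1⟩

/-- The metric graph `Γ(G; l)`: the edges of length zero are contracted, and every other edge `e`
is given the length `l e`. -/
noncomputable def metricGraph (G : Graph α β) (l : E(G) → ℝ) (hl : l ∈ closedLengths G) :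
    MetricGraph (Quot (contractRel G (zeroEdges G l))) β where
  graph := contract G (zeroEdges G l)
  start e := Quot.mk _ (ends G (origEdge e)).1
  finish e := Quot.mk _ (ends G (origEdge e)).2
  isLink e := by
    refine Graph.IsLink.map _ ?_
    have h := ends_isLink G (origEdge e)
    rw [Graph.deleteEdges_isLink]
    exact ⟨h, e.2.2⟩
  length e := l (origEdge e)
  length_pos e :=
    lt_of_le_of_ne (closedLengths_nonneg hl _) fun h => e.2.2 ⟨e.2.1, h.symm⟩

/-- `Γ(G; l)` is a supremizer of `G`: it has the largest spectral gap among all `Γ(G; m)`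
with `m` in the closure of the space of lengths. -/
def IsSupremizer (G : Graph α β) (l : E(G) → ℝ) (hl : l ∈ closedLengths G) : Prop :=
  ∀ (m : E(G) → ℝ) (hm : m ∈ closedLengths G),
    (metricGraph G m hm).spectralGap ≤ (metricGraph G l hl).spectralGap

end QuantumGraph

/-!
The spectral gap of a metric graph of total length one is the optimal constant `k` in the Poincaré
inequality `k² Var f ≤ ∫ |f'|²`. This is proved by maximizing the variance, as a compact quadratic
form in the derivative `g = f'`, over the unit ball of the closed subspace `admissible` of `L²`; the
lemma of du Bois-Reymond turns the weak equation of a maximizer into `f'' = -k² f` on each edge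
together with the Kirchhoff conditions (`exists_isEigenfunction_poincare`). Contracted edges stay in
the picture as intervals of length zero, so that all lengths `l` share the same discrete graph; only
`IsEigenfunction.isEigenvalue` and `exists_isEigenfunction_of_isEigenvalue` pass between this
description and the eigenvalues of the contracted metric graph.

*Existence.* An eigenfunction for the lengths `l`, rescaled on each edge, is a test function for all
lengths `m` near `l`, and its Rayleigh quotient depends continuously on `m`
(`IsEigenfunction.eventually_poincare_lt`). Hence the spectral gap is upper semicontinuous on the
compact set of all lengths, and attains its maximum there.

*A supremizer is not a tree.* Suppose that the edges of positive length form a tree. An edge `e₀` of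
the discrete graph lies on a cycle, and is contracted in the tree to a point, which serves as root;
let `r` be the number of leaves apart from the root, that is, of edges whose far side, seen from the
root, contains no further edge.

* The distances between pairs of the `r + 1` points given by the root and the leaves are at least
  `2 / (r + 1)` on average, since each edge of the tree separates at least `r` pairs
  (`IsCutFamily.exists_cutDist_ge`). If two points have distance `D`, then the function that is
  `cos (π x / D)` on the path between them and constant on the branches shows that the spectral gap
  is at most `π / D` (`Poincare.le_pi_div_cutDist`), so it is at most `π (r + 1) / 2`.
* Contract all edges except `e₀` and the `r` edges at the leaves: this gives a stower, that is, a
  loop with `r` pendant edges. With length `a = 1 / (r + 2)` of the pendant edges and `2 a` of the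
  loop, its spectral gap is at least `π / (2 a) = π (r + 2) / 2`
  (`IsEigenfunction.pi_div_two_le_of_stower`), which is larger.

Trees and cycles enter through functions on the vertices: an edge is a bridge if some vertex
function changes along this edge only (`IsCutFamily`, `exists_not_bridge`).
-/

namespace QuantumGraph

open Filter Topology Set

/-! ### Maximizers of compact quadratic forms -/

/-- If `B ≠ 0` is a bounded nonnegative symmetric form such that each bounded sequence has a
subsequence that is Cauchy with respect to `B`, then `B` has a largest eigenvalue
`μ`. By the parallelogram law, a maximizing sequence that is Cauchy with respect to `B` is also
Cauchy in norm. -/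
theorem exists_maximizer_of_compact_form {H : Type*} [NormedAddCommGroup H]
    [InnerProductSpace ℝ H] [CompleteSpace H] (B : H →ₗ[ℝ] H →ₗ[ℝ] ℝ)
    (hsymm : ∀ g h, B g h = B h g) (hnonneg : ∀ g, 0 ≤ B g g) (C : ℝ)
    (hC : ∀ g, B g g ≤ C * ‖g‖ ^ 2)
    (hcomp : ∀ g : ℕ → H, (∀ n, ‖g n‖ ≤ 1) → ∃ σ : ℕ → ℕ, StrictMono σ ∧
      ∀ ε > 0, ∃ N, ∀ m ≥ N, ∀ n ≥ N, B (g (σ m) - g (σ n)) (g (σ m) - g (σ n)) < ε)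
    (hne : ∃ g, 0 < B g g) :
    ∃ (g : H) (μ : ℝ), 0 < μ ∧ g ≠ 0 ∧ (∀ h, B g h = μ * inner ℝ g h) ∧
      ∀ h, B h h ≤ μ * ‖h‖ ^ 2 := by
  set S : Set ℝ := {r | ∃ g : H, ‖g‖ ≤ 1 ∧ B g g = r} with hS
  have hCle : ∀ g : H, ‖g‖ ≤ 1 → B g g ≤ |C| := fun g hg => by
    have h1 : ‖g‖ ^ 2 ≤ 1 := pow_le_one₀ (norm_nonneg _) hg
    have h2 := hC g
    have h3 : C * ‖g‖ ^ 2 ≤ |C| * ‖g‖ ^ 2 := by gcongr; exact le_abs_self C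
    nlinarith [abs_nonneg C]
  have hbdd : BddAbove S := ⟨|C|, by rintro _ ⟨g, hg, rfl⟩; exact hCle g hg⟩
  have hSne : S.Nonempty := ⟨0, 0, by simp, by simp⟩
  set μ := sSup S with hμdef
  have hle1 : ∀ g : H, ‖g‖ ≤ 1 → B g g ≤ μ := fun g hg => le_csSup hbdd ⟨g, hg, rfl⟩
  have hle : ∀ h : H, B h h ≤ μ * ‖h‖ ^ 2 := by
    intro h
    by_cases hh : h = 0
    · simp [hh]
    have hn : 0 < ‖h‖ := norm_pos_iff.2 hh
    have h1 := hle1 (‖h‖⁻¹ • h) (by rw [norm_smul, norm_inv, norm_norm, inv_mul_cancel₀ hn.ne'])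
    simp only [map_smul, LinearMap.smul_apply, smul_eq_mul] at h1
    have : B h h = (‖h‖⁻¹ * (‖h‖⁻¹ * B h h)) * ‖h‖ ^ 2 := by field_simp
    rw [this]; gcongr
  have hμ : 0 < μ := by
    obtain ⟨g, hg⟩ := hne
    have h1 := hle g
    by_contra hcon
    push Not at hcon
    nlinarith [sq_nonneg ‖g‖]
  obtain ⟨r, -, hrlim, hrS⟩ := exists_seq_tendsto_sSup hSne hbdd
  choose g₀ hg₀ hg₀r using hrS
  obtain ⟨σ, hσ, hcau⟩ := hcomp g₀ hg₀
  set g : ℕ → H := fun n => g₀ (σ n) with hgdef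
  have hg1 : ∀ n, ‖g n‖ ≤ 1 := fun n => hg₀ _
  have hq : Tendsto (fun n => B (g n) (g n)) atTop (𝓝 μ) := by
    have : (fun n => B (g n) (g n)) = r ∘ σ := by
      funext n; simp [hgdef, hg₀r]
    rw [this]; exact hrlim.comp hσ.tendsto_atTop
  have hpar : ∀ x y : H, B (x + y) (x + y) = 2 * B x x + 2 * B y y - B (x - y) (x - y) := by
    intro x y; simp only [map_add, map_sub, LinearMap.add_apply, LinearMap.sub_apply]; ring
  have hgC : CauchySeq g := by
    rw [Metric.cauchySeq_iff]
    intro ε hε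
    have hδ : 0 < μ * ε ^ 2 / 8 := by positivity
    obtain ⟨N₁, hN₁⟩ := hcau _ hδ
    obtain ⟨N₂, hN₂⟩ := eventually_atTop.1 (hq.eventually (lt_mem_nhds (sub_lt_self μ hδ)))
    refine ⟨max N₁ N₂, fun m hm n hn => ?_⟩
    have a1 := hN₁ m (le_of_max_le_left hm) n (le_of_max_le_left hn)
    have a2 := hN₂ m (le_of_max_le_right hm)
    have a3 := hN₂ n (le_of_max_le_right hn)
    have a4 := hle (g m + g n)
    rw [hpar] at a4
    have a5 := parallelogram_law_with_norm ℝ (g m) (g n)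
    have a6 : ‖g m‖ ^ 2 ≤ 1 := pow_le_one₀ (norm_nonneg _) (hg1 m)
    have a7 : ‖g n‖ ^ 2 ≤ 1 := pow_le_one₀ (norm_nonneg _) (hg1 n)
    have a8 : ‖g m + g n‖ ^ 2 ≤ 4 - ‖g m - g n‖ ^ 2 := by nlinarith
    have a9 : μ * ‖g m + g n‖ ^ 2 ≤ μ * (4 - ‖g m - g n‖ ^ 2) := by gcongr
    have a10 : μ * ‖g m - g n‖ ^ 2 < μ * ε ^ 2 := by
      have : B (g m - g n) (g m - g n) < μ * ε ^ 2 / 8 := a1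
      linarith
    rw [dist_eq_norm]
    exact lt_of_pow_lt_pow_left₀ 2 hε.le (lt_of_mul_lt_mul_left a10 hμ.le)
  obtain ⟨a, ha⟩ := cauchySeq_tendsto_of_complete hgC
  have ha1 : ‖a‖ ≤ 1 := le_of_tendsto ha.norm (Eventually.of_forall hg1)
  have hqa : μ ≤ B a a := by
    have hlow : ∀ n, B (g n) (g n) - 2 * (|C| * ‖g n - a‖) ≤ B a a := by
      intro n
      set d := g n - a with hd
      have e1 : B a a = B (g n) (g n) - 2 * B (g n) d + B d d := by
        have : a = g n - d := by simp [hd]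
        rw [this]
        simp only [map_sub, LinearMap.sub_apply, hsymm d (g n)]; ring
      -- the Cauchy-Schwarz inequality for `B`
      have e2 : B (g n) d ≤ |C| * ‖d‖ := by
        by_cases hd0 : d = 0
        · simp [hd0]
        have hdp : 0 < ‖d‖ := norm_pos_iff.2 hd0
        have e3 := hnonneg (‖d‖ • g n - d)
        simp only [map_sub, map_smul, LinearMap.sub_apply, LinearMap.smul_apply, smul_eq_mul,
          hsymm d (g n)] at e3
        have e4 := hCle _ (hg1 n)
        have e5 : B d d ≤ |C| * ‖d‖ ^ 2 :=
          (hC d).trans (by gcongr; exact le_abs_self C)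
        have e6 : ‖d‖ * (B (g n) d) ≤ ‖d‖ * (|C| * ‖d‖) := by
          nlinarith [mul_le_mul_of_nonneg_left e4 (sq_nonneg ‖d‖)]
        exact le_of_mul_le_mul_left e6 hdp
      have := hnonneg d
      linarith
    have hd0 : Tendsto (fun n => ‖g n - a‖) atTop (𝓝 0) := tendsto_iff_norm_sub_tendsto_zero.1 ha
    have hlim : Tendsto (fun n => B (g n) (g n) - 2 * (|C| * ‖g n - a‖)) atTop
        (𝓝 (μ - 2 * (|C| * 0))) := hq.sub ((hd0.const_mul _).const_mul _)
    have := le_of_tendsto hlim (Eventually.of_forall hlow)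
    simpa using this
  have ha2 : ‖a‖ ^ 2 ≤ 1 := pow_le_one₀ (norm_nonneg _) ha1
  refine ⟨a, μ, hμ, ?_, ?_, hle⟩
  · rintro rfl
    simp at hqa; linarith
  · intro h
    -- the quadratic `τ ↦ μ ‖a + τ h‖² - B(a + τ h, a + τ h)` is nonnegative and at most `0` at `0`
    have key : ∀ τ : ℝ, 0 ≤ 2 * τ * (μ * inner ℝ a h - B a h) + τ ^ 2 * (μ * ‖h‖ ^ 2 - B h h) := by
      intro τ
      have k1 := hle (a + τ • h)
      rw [norm_add_sq_real, norm_smul, inner_smul_right, mul_pow, Real.norm_eq_abs, sq_abs] at k1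
      simp only [map_add, map_smul, LinearMap.add_apply, LinearMap.smul_apply, smul_eq_mul,
        hsymm h a] at k1
      nlinarith
    set p := μ * inner ℝ a h - B a h with hp
    set q := μ * ‖h‖ ^ 2 - B h h with hqq
    have hq0 : 0 ≤ q := sub_nonneg.2 (hle h)
    have := key (-(p / (q + 1)))
    have hp0 : p ^ 2 = 0 := by
      have e : 2 * -(p / (q + 1)) * p + (-(p / (q + 1))) ^ 2 * q
          = -(p ^ 2 * ((q + 2) / (q + 1) ^ 2)) := by field_simp; ring
      rw [e] at this
      have h2 : 0 < (q + 2) / (q + 1) ^ 2 := by positivity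
      nlinarith [sq_nonneg p]
    have := pow_eq_zero_iff (two_ne_zero) |>.1 hp0
    linarith

/-! ### The equation `f'' = -k² f` on an interval -/

theorem hasDerivAt_cos_mul (k x : ℝ) :
    HasDerivAt (fun x => Real.cos (k * x)) (-(k * Real.sin (k * x))) x := by
  have := (Real.hasDerivAt_cos (k * x)).comp x ((hasDerivAt_id x).const_mul k)
  simpa [Function.comp_def, mul_comm] using this

theorem hasDerivAt_sin_mul (k x : ℝ) :
    HasDerivAt (fun x => Real.sin (k * x)) (k * Real.cos (k * x)) x := by
  have := (Real.hasDerivAt_sin (k * x)).comp x ((hasDerivAt_id x).const_mul k)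
  simpa [Function.comp_def, mul_comm] using this

/-- Solving `f'' = -k² f` in integral form on `[0, l]`. -/
theorem eq_cos_add_sin_of_integral_eq {V : Type*} [NormedAddCommGroup V] [NormedSpace ℝ V]
    [CompleteSpace V] {l k : ℝ} (hl : 0 ≤ l) (hk : 0 < k) {f f' : ℝ → V}
    (hc : ContinuousOn f (Icc 0 l))
    (hf' : ∀ x ∈ Icc 0 l, f' x = f' 0 - (k ^ 2) • ∫ t in (0 : ℝ)..x, f t)
    (hf : ∀ x ∈ Icc 0 l, f x = f 0 + ∫ t in (0 : ℝ)..x, f' t) {x : ℝ} (hx : x ∈ Icc 0 l) :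
    f x = Real.cos (k * x) • f 0 + Real.sin (k * x) • (k⁻¹ • f' 0) ∧
      f' x = -(k * Real.sin (k * x)) • f 0 + (k * Real.cos (k * x)) • (k⁻¹ • f' 0) := by
  -- `f` is only known to be continuous on `[0, l]`: extend it, and integrate the extension
  set fh : ℝ → V := IccExtend hl ((Icc 0 l).domRestrict f) with hfh
  have hfhc : Continuous fh := (continuousOn_iff_continuous_domRestrict.1 hc).Icc_extend'
  have hfhe : ∀ x ∈ Icc 0 l, fh x = f x := fun x hx => by
    rw [hfh, IccExtend_of_mem hl _ hx]; rfl
  set F' : ℝ → V := fun x => f' 0 - (k ^ 2) • ∫ t in (0 : ℝ)..x, fh t with hF'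
  have hF'd : ∀ x, HasDerivAt F' (-((k ^ 2) • fh x)) x := fun x => by
    have := ((hfhc.integral_hasStrictDerivAt 0 x).hasDerivAt.const_smul (k ^ 2)).const_sub (f' 0)
    simpa [hF'] using this
  have hF'c : Continuous F' := continuous_iff_continuousAt.2 fun x => (hF'd x).continuousAt
  set F : ℝ → V := fun x => f 0 + ∫ t in (0 : ℝ)..x, F' t with hF
  have hFd : ∀ x, HasDerivAt F (F' x) x := fun x =>
    ((hF'c.integral_hasStrictDerivAt 0 x).hasDerivAt.const_add (f 0))
  have sub : ∀ {x}, x ∈ Icc 0 l → uIcc 0 x ⊆ Icc 0 l := fun {x} hx => by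
    rw [uIcc_of_le hx.1]; exact Icc_subset_Icc_right hx.2
  have hF'e : ∀ x ∈ Icc 0 l, F' x = f' x := fun x hx => by
    rw [hf' x hx, hF']
    simp only
    rw [intervalIntegral.integral_congr fun t ht => hfhe t (sub hx ht)]
  have hFe : ∀ x ∈ Icc 0 l, F x = f x := fun x hx => by
    rw [hf x hx, hF]
    simp only
    rw [intervalIntegral.integral_congr fun t ht => hF'e t (sub hx ht)]
  have hcosd := hasDerivAt_cos_mul k
  have hsind := hasDerivAt_sin_mul k
  -- variation of constants: the two coefficients below have zero derivative
  set P : ℝ → V := fun x => Real.cos (k * x) • F x - Real.sin (k * x) • (k⁻¹ • F' x) with hP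
  set Q : ℝ → V := fun x => Real.sin (k * x) • F x + Real.cos (k * x) • (k⁻¹ • F' x) with hQ
  have hPd : ∀ x ∈ Icc 0 l, HasDerivAt P 0 x := fun x hx => by
    have h1 := ((hcosd x).smul (hFd x)).sub ((hsind x).smul ((hF'd x).const_smul k⁻¹))
    refine (show HasDerivAt P _ x from h1).congr_deriv ?_
    rw [hfhe x hx, ← hFe x hx]
    simp only [Pi.smul_apply, smul_neg, smul_smul]
    match_scalars <;> field_simp <;> ring
  have hQd : ∀ x ∈ Icc 0 l, HasDerivAt Q 0 x := fun x hx => by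
    have h1 := ((hsind x).smul (hFd x)).add ((hcosd x).smul ((hF'd x).const_smul k⁻¹))
    refine (show HasDerivAt Q _ x from h1).congr_deriv ?_
    rw [hfhe x hx, ← hFe x hx]
    simp only [Pi.smul_apply, smul_neg, smul_smul]
    match_scalars <;> field_simp <;> ring
  have hconst : ∀ R : ℝ → V, (∀ x ∈ Icc 0 l, HasDerivAt R 0 x) → R x = R 0 := fun R hR =>
    constant_of_has_deriv_right_zero (fun y hy => (hR y hy).continuousAt.continuousWithinAt)
      (fun y hy => (hR y (Ico_subset_Icc_self hy)).hasDerivWithinAt) x hx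
  have h0 : (0 : ℝ) ∈ Icc 0 l := ⟨le_rfl, hl⟩
  have eP := hconst P hPd
  have eQ := hconst Q hQd
  simp only [hP, hQ, hFe x hx, hF'e x hx, hFe 0 h0, hF'e 0 h0, mul_zero, Real.cos_zero,
    Real.sin_zero, one_smul, zero_smul, sub_zero, zero_add] at eP eQ
  have hcs := Real.sin_sq_add_cos_sq (k * x)
  set c := Real.cos (k * x)
  set s := Real.sin (k * x)
  rw [← eP, ← eQ]
  constructor
  · simp only [smul_sub, smul_add, smul_smul]
    have : f x = (s ^ 2 + c ^ 2) • f x := by rw [hcs, one_smul]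
    conv_lhs => rw [this]
    match_scalars <;> field_simp <;> ring
  · simp only [smul_sub, smul_add, smul_smul]
    have : f' x = (s ^ 2 + c ^ 2) • f' x := by rw [hcs, one_smul]
    conv_lhs => rw [this]
    match_scalars <;> field_simp <;> ring

/-! ### Square integrable functions on an interval and their primitives -/

/-- The square integrable functions on the interval `[0, l]`. -/
abbrev IntervalL2 (l : ℝ) : Type := Lp ℝ 2 (volume.restrict (Ioc 0 l))

/-- The primitive `∫₀ˣ g` of a square integrable function on `[0, l]`, as a functional of `g`. -/
noncomputable def primitive (l x : ℝ) : IntervalL2 l →L[ℝ] ℝ :=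
  innerSL ℝ (indicatorConstLp 2 (measurableSet_Ioc (a := 0) (b := x))
    (measure_ne_top (volume.restrict (Ioc 0 l)) _) (1 : ℝ))

theorem primitive_apply (l x : ℝ) (g : IntervalL2 l) :
    primitive l x g = ∫ y in Ioc 0 x, g y ∂(volume.restrict (Ioc 0 l)) := by
  rw [primitive, innerSL_apply_apply, L2.inner_indicatorConstLp_one]

theorem primitive_eq_intervalIntegral {l x : ℝ} (hx : x ∈ Icc 0 l) (g : IntervalL2 l) :
    primitive l x g = ∫ y in (0 : ℝ)..x, g y := by
  rw [primitive_apply, Measure.restrict_restrict measurableSet_Ioc, Ioc_inter_Ioc,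
    intervalIntegral.integral_of_le hx.1]
  simp [hx.2]

theorem IntervalL2.integrable {l : ℝ} (g : IntervalL2 l) :
    Integrable g (volume.restrict (Ioc 0 l)) :=
  (Lp.memLp g).integrable (by norm_num)

theorem IntervalL2.intervalIntegrable {l : ℝ} (hl : 0 ≤ l) (g : IntervalL2 l) :
    IntervalIntegrable g volume 0 l := by
  rw [intervalIntegrable_iff_integrableOn_Ioc_of_le hl]
  exact g.integrable

theorem norm_indicatorConstLp_Ioc_le (l : ℝ) {x y : ℝ} (hyx : y ≤ x) :
    ‖indicatorConstLp 2 (measurableSet_Ioc (a := y) (b := x))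
      (measure_ne_top (volume.restrict (Ioc 0 l)) _) (1 : ℝ)‖ ≤ √(x - y) := by
  refine norm_indicatorConstLp_le.trans ?_
  rw [norm_one, one_mul, Real.sqrt_eq_rpow]
  have h1 : (volume.restrict (Ioc 0 l)).real (Ioc y x) ≤ x - y := by
    rw [measureReal_def]
    refine ENNReal.toReal_le_of_le_ofReal (sub_nonneg.2 hyx) ?_
    exact (Measure.restrict_apply_le _ _).trans (by rw [Real.volume_Ioc])
  have h2 : (1 : ℝ) / (2 : ENNReal).toReal = 1 / 2 := by norm_num
  rw [h2]
  exact Real.rpow_le_rpow measureReal_nonneg h1 (by norm_num)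

theorem abs_primitive_sub_le (l : ℝ) {x y : ℝ} (hyx : y ≤ x) (g : IntervalL2 l) :
    |primitive l x g - primitive l y g| ≤ √(x - y) * ‖g‖ := by
  have key : primitive l x g - primitive l y g = inner ℝ (indicatorConstLp 2
      (measurableSet_Ioc (a := max 0 y) (b := max x (max 0 y)))
      (measure_ne_top (volume.restrict (Ioc 0 l)) _) (1 : ℝ)) g := by
    rw [L2.inner_indicatorConstLp_one, primitive_apply, primitive_apply]
    rcases le_total x 0 with hx | hx
    · have hy : y ≤ 0 := hyx.trans hx
      simp [hy, hx]
    rcases le_total y 0 with hy | hy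
    · simp [hy, hx]
    · simp only [max_eq_right hy, max_eq_left hyx]
      rw [← Ioc_union_Ioc_eq_Ioc hy hyx, setIntegral_union (Ioc_disjoint_Ioc_of_le le_rfl)
        measurableSet_Ioc g.integrable.integrableOn g.integrable.integrableOn]
      ring
  rw [key]
  refine (abs_real_inner_le_norm _ _).trans ?_
  gcongr
  refine (norm_indicatorConstLp_Ioc_le l (le_max_right _ _)).trans (Real.sqrt_le_sqrt ?_)
  rcases le_total x (max 0 y) with h | h
  · rw [max_eq_right h]; linarith
  · rw [max_eq_left h]; linarith [le_max_right 0 y]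

theorem primitive_zero (l : ℝ) (g : IntervalL2 l) : primitive l 0 g = 0 := by
  simp [primitive_apply]

theorem abs_primitive_le (l : ℝ) {x : ℝ} (h0 : 0 ≤ x) (h1 : x ≤ 1) (g : IntervalL2 l) :
    |primitive l x g| ≤ ‖g‖ := by
  have h := abs_primitive_sub_le l h0 g
  rw [primitive_zero, sub_zero, sub_zero] at h
  refine h.trans ?_
  have : √x ≤ 1 := Real.sqrt_le_one.2 h1
  nlinarith [norm_nonneg g]

theorem abs_primitive_sub_le' (l x y : ℝ) (g : IntervalL2 l) :
    |primitive l x g - primitive l y g| ≤ √|x - y| * ‖g‖ := by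
  rcases le_total y x with h | h
  · rw [abs_of_nonneg (sub_nonneg.2 h)]; exact abs_primitive_sub_le l h g
  · rw [abs_sub_comm, abs_sub_comm x y, abs_of_nonneg (sub_nonneg.2 h)]
    exact abs_primitive_sub_le l h g

theorem continuous_primitive (l : ℝ) (g : IntervalL2 l) :
    Continuous fun x => primitive l x g := by
  rw [continuous_iff_continuousAt]
  intro y
  rw [ContinuousAt, tendsto_iff_dist_tendsto_zero]
  have h : Tendsto (fun x => √|x - y| * ‖g‖) (𝓝 y) (𝓝 (√|y - y| * ‖g‖)) :=
    Continuous.tendsto (by fun_prop) y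
  simp only [sub_self, abs_zero, Real.sqrt_zero, zero_mul] at h
  exact squeeze_zero (fun _ => dist_nonneg) (fun x => abs_primitive_sub_le' l x y g) h

/-- The square integrable function on `[0, l]` given by a continuous function. -/
noncomputable def IntervalL2.ofContinuous (l : ℝ) (f : ℝ → ℝ) (hf : Continuous f) : IntervalL2 l :=
  MemLp.toLp f <| by
    obtain ⟨C, hC⟩ := (isCompact_Icc (a := (0 : ℝ)) (b := l)).exists_bound_of_continuousOn
      hf.continuousOn
    refine MemLp.of_bound hf.aestronglyMeasurable C ?_
    filter_upwards [ae_restrict_mem measurableSet_Ioc] with x hx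
    exact hC x (Ioc_subset_Icc_self hx)

theorem IntervalL2.coeFn_ofContinuous (l : ℝ) (f : ℝ → ℝ) (hf : Continuous f) :
    IntervalL2.ofContinuous l f hf =ᵐ[volume.restrict (Ioc 0 l)] f :=
  MemLp.coeFn_toLp _

theorem IntervalL2.inner_ofContinuous {l : ℝ} (hl : 0 ≤ l) (g : IntervalL2 l) (f : ℝ → ℝ)
    (hf : Continuous f) :
    inner ℝ g (IntervalL2.ofContinuous l f hf) = ∫ x in (0 : ℝ)..l, g x * f x := by
  rw [L2.inner_def, intervalIntegral.integral_of_le hl]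
  refine integral_congr_ae ?_
  filter_upwards [IntervalL2.coeFn_ofContinuous l f hf] with x hx
  simp [hx, mul_comm]

theorem IntervalL2.intervalIntegral_congr {l x : ℝ} (hx : x ∈ Icc 0 l) {g f : ℝ → ℝ}
    (h : g =ᵐ[volume.restrict (Ioc 0 l)] f) :
    ∫ y in (0 : ℝ)..x, g y = ∫ y in (0 : ℝ)..x, f y := by
  rw [intervalIntegral.integral_of_le hx.1, intervalIntegral.integral_of_le hx.1]
  exact integral_congr_ae (ae_mono (Measure.restrict_mono (Ioc_subset_Ioc_right hx.2) le_rfl) h)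

/-- Integration by parts against the primitive of a square integrable function. -/
theorem integral_mul_primitive {l : ℝ} (hl : 0 ≤ l) (F : ℝ → ℝ) (hF : Continuous F)
    (h : IntervalL2 l) (h0 : primitive l l h = 0) :
    ∫ x in (0 : ℝ)..l, F x * primitive l x h =
      - ∫ x in (0 : ℝ)..l, h x * ∫ t in (0 : ℝ)..x, F t := by
  have hi := h.intervalIntegrable hl
  have e0 : (0 : ℝ) ∈ uIcc 0 l := left_mem_uIcc
  have a1 := (hF.intervalIntegrable 0 l).absolutelyContinuousOnInterval_intervalIntegral e0
  have a2 := hi.absolutelyContinuousOnInterval_intervalIntegral e0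
  have ibp := a1.integral_deriv_mul_eq_sub a2
  have hl' : l ∈ Icc 0 l := ⟨hl, le_rfl⟩
  rw [← primitive_eq_intervalIntegral hl' h, h0] at ibp
  simp only [intervalIntegral.integral_same, mul_zero, sub_zero] at ibp
  have hcongr : ∀ᵐ x, x ∈ uIoc 0 l →
      deriv (fun x => ∫ v in (0 : ℝ)..x, F v) x * (∫ v in (0 : ℝ)..x, h v) +
        (∫ v in (0 : ℝ)..x, F v) * deriv (fun x => ∫ v in (0 : ℝ)..x, h v) x =
      F x * primitive l x h + h x * ∫ t in (0 : ℝ)..x, F t := by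
    filter_upwards [hi.ae_hasDerivAt_integral] with x hx hxm
    have hxm' : x ∈ uIcc 0 l := uIoc_subset_uIcc hxm
    rw [(hx hxm' 0 e0).deriv, hF.deriv_integral, primitive_eq_intervalIntegral
      (by rwa [uIcc_of_le hl] at hxm')]
    ring
  rw [intervalIntegral.integral_congr_ae hcongr, intervalIntegral.integral_add] at ibp
  · linarith
  · exact (hF.mul (continuous_primitive l h)).intervalIntegrable _ _
  · refine hi.mul_continuousOn (Continuous.continuousOn ?_)
    exact intervalIntegral.continuous_primitive (fun a b => hF.intervalIntegrable a b) 0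

/-- The lemma of du Bois-Reymond: the weak form of `(μ g)' = -F` determines `g` up to a
constant. -/
theorem ae_eq_of_weak_equation {l μ : ℝ} (hl : 0 ≤ l) (hμ : μ ≠ 0) (F : ℝ → ℝ)
    (hF : Continuous F) (g : IntervalL2 l)
    (hw : ∀ h : IntervalL2 l, primitive l l h = 0 →
      ∫ x in (0 : ℝ)..l, F x * primitive l x h = μ * inner ℝ g h) :
    ∃ c : ℝ, g =ᵐ[volume.restrict (Ioc 0 l)] fun x => μ⁻¹ * (c - ∫ t in (0 : ℝ)..x, F t) := by
  have hΦ : Continuous fun x => ∫ t in (0 : ℝ)..x, F t :=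
    intervalIntegral.continuous_primitive (fun a b => hF.intervalIntegrable a b) 0
  set Φ := IntervalL2.ofContinuous l _ hΦ with hΦdef
  set one : IntervalL2 l := indicatorConstLp 2 (measurableSet_Ioc (a := 0) (b := l))
    (measure_ne_top (volume.restrict (Ioc 0 l)) _) (1 : ℝ) with hone
  have hmem : μ • g + Φ ∈ (ℝ ∙ one)ᗮᗮ := by
    rw [Submodule.mem_orthogonal]
    intro h hh
    have hh0 : primitive l l h = 0 := by
      rw [primitive, innerSL_apply_apply]
      exact Submodule.mem_orthogonal_singleton_iff_inner_right.1 hh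
    have h1 := hw h hh0
    rw [integral_mul_primitive hl F hF h hh0, ← IntervalL2.inner_ofContinuous hl h _ hΦ] at h1
    rw [inner_add_right, inner_smul_right, real_inner_comm, ← h1]
    ring
  rw [Submodule.orthogonal_orthogonal, Submodule.mem_span_singleton] at hmem
  obtain ⟨c, hc⟩ := hmem
  refine ⟨c, ?_⟩
  have hg : g = μ⁻¹ • (c • one - Φ) := by
    rw [hc]; simp [smul_smul, inv_mul_cancel₀ hμ]
  have e1 : one =ᵐ[volume.restrict (Ioc 0 l)] fun _ => (1 : ℝ) := by
    filter_upwards [indicatorConstLp_coeFn (p := 2) (hs := measurableSet_Ioc (a := 0) (b := l))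
      (hμs := measure_ne_top (volume.restrict (Ioc 0 l)) _) (c := (1 : ℝ)),
      ae_restrict_mem measurableSet_Ioc] with x hx hxm
    rw [hone, hx, indicator_of_mem hxm]
  have e2 : Φ =ᵐ[volume.restrict (Ioc 0 l)] _ := IntervalL2.coeFn_ofContinuous l _ hΦ
  rw [hg]
  filter_upwards [e1, e2, Lp.coeFn_smul μ⁻¹ (c • one - Φ), Lp.coeFn_sub (c • one) Φ,
    Lp.coeFn_smul c one] with x h1 h2 h3 h4 h5
  rw [h3, Pi.smul_apply, h4, Pi.sub_apply, h5, Pi.smul_apply, h1, h2]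
  simp

/-! ### The covariance of functions on a metric graph -/

section Covariance

variable {E : Type*} [Fintype E]

/-- The covariance of two families of functions on the edges `[0, l e]`, for the measure given by
the edge lengths (a probability measure if the total length is one). -/
noncomputable def cov (l : E → ℝ) (f h : E → ℝ → ℝ) : ℝ :=
  (∑ e, ∫ x in (0 : ℝ)..l e, f e x * h e x) -
    (∑ e, ∫ x in (0 : ℝ)..l e, f e x) * ∑ e, ∫ x in (0 : ℝ)..l e, h e x

theorem cov_comm (l : E → ℝ) (f h : E → ℝ → ℝ) : cov l f h = cov l h f := by
  simp only [cov, mul_comm]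

theorem cov_congr {l : E → ℝ} (hl : ∀ e, 0 ≤ l e) {f f' h h' : E → ℝ → ℝ}
    (hf : ∀ e, ∀ x ∈ Icc 0 (l e), f e x = f' e x) (hh : ∀ e, ∀ x ∈ Icc 0 (l e), h e x = h' e x) :
    cov l f h = cov l f' h' := by
  have key : ∀ {u v : E → ℝ → ℝ}, (∀ e, ∀ x ∈ Icc 0 (l e), u e x = v e x) →
      ∀ e, ∫ x in (0 : ℝ)..l e, u e x = ∫ x in (0 : ℝ)..l e, v e x := fun {u v} huv e =>
    intervalIntegral.integral_congr fun x hx => huv e x (by rwa [uIcc_of_le (hl e)] at hx)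
  simp only [cov]
  rw [Finset.sum_congr rfl fun e _ => key hf e, Finset.sum_congr rfl fun e _ => key hh e,
    Finset.sum_congr rfl fun e _ => key (u := fun e x => f e x * h e x)
      (v := fun e x => f' e x * h' e x) (fun e x hx => by simp only [hf e x hx, hh e x hx]) e]

theorem cov_add_left (l : E → ℝ) {f f' h : E → ℝ → ℝ} (hf : ∀ e, Continuous (f e))
    (hf' : ∀ e, Continuous (f' e)) (hh : ∀ e, Continuous (h e)) :
    cov l (fun e x => f e x + f' e x) h = cov l f h + cov l f' h := by
  have h1 : ∀ e, ∫ x in (0 : ℝ)..l e, (f e x + f' e x) =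
      (∫ x in (0 : ℝ)..l e, f e x) + ∫ x in (0 : ℝ)..l e, f' e x := fun e =>
    intervalIntegral.integral_add ((hf e).intervalIntegrable _ _)
      ((hf' e).intervalIntegrable _ _)
  have h2 : ∀ e, ∫ x in (0 : ℝ)..l e, (f e x + f' e x) * h e x =
      (∫ x in (0 : ℝ)..l e, f e x * h e x) + ∫ x in (0 : ℝ)..l e, f' e x * h e x := fun e => by
    simp only [add_mul]
    exact intervalIntegral.integral_add (((hf e).mul (hh e)).intervalIntegrable _ _)
      (((hf' e).mul (hh e)).intervalIntegrable _ _)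
  simp only [cov, h1, h2, Finset.sum_add_distrib]
  ring

theorem cov_smul_left (l : E → ℝ) (c : ℝ) (f h : E → ℝ → ℝ) :
    cov l (fun e x => c * f e x) h = c * cov l f h := by
  simp only [cov, mul_assoc, intervalIntegral.integral_const_mul, ← Finset.mul_sum]
  ring

theorem cov_const_left {l : E → ℝ} (hl1 : ∑ e, l e = 1) (c : ℝ) (h : E → ℝ → ℝ) :
    cov l (fun _ _ => c) h = 0 := by
  simp [cov, intervalIntegral.integral_const_mul, ← Finset.mul_sum, ← Finset.sum_mul, hl1]

theorem cov_add_const {l : E → ℝ} (hl1 : ∑ e, l e = 1) {f h : E → ℝ → ℝ}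
    (hf : ∀ e, Continuous (f e)) (hh : ∀ e, Continuous (h e)) (c d : ℝ) :
    cov l (fun e x => f e x + c) (fun e x => h e x + d) = cov l f h := by
  rw [cov_add_left l (h := fun e x => h e x + d) hf (fun _ => continuous_const)
      (fun e => (hh e).add continuous_const),
    cov_const_left hl1, cov_comm, cov_add_left l hh (fun _ => continuous_const) hf,
    cov_const_left hl1, cov_comm]
  ring

theorem cov_self_le_sum (l : E → ℝ) (f : E → ℝ → ℝ) :
    cov l f f ≤ ∑ e, ∫ x in (0 : ℝ)..l e, f e x ^ 2 := by
  simp only [cov, sq]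
  nlinarith [mul_self_nonneg (∑ e, ∫ x in (0 : ℝ)..l e, f e x)]

theorem exists_cov_self_eq {l : E → ℝ} (hl1 : ∑ e, l e = 1) {f : E → ℝ → ℝ}
    (hf : ∀ e, Continuous (f e)) :
    ∃ m : ℝ, cov l f f = ∑ e, ∫ x in (0 : ℝ)..l e, (f e x - m) ^ 2 := by
  set m := ∑ e, ∫ x in (0 : ℝ)..l e, f e x with hm
  have h0 : ∑ e, ∫ x in (0 : ℝ)..l e, (f e x + -m) = 0 := by
    have : ∀ e, ∫ x in (0 : ℝ)..l e, (f e x + -m) = (∫ x in (0 : ℝ)..l e, f e x) + l e * -m :=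
      fun e => by
        rw [intervalIntegral.integral_add ((hf e).intervalIntegrable _ _)
          (continuous_const.intervalIntegrable _ _)]
        simp
    simp only [this, Finset.sum_add_distrib, ← Finset.sum_mul, hl1, ← hm]
    ring
  refine ⟨m, ?_⟩
  rw [← cov_add_const hl1 hf hf (-m) (-m), cov, h0, zero_mul, sub_zero]
  simp only [sq, sub_eq_add_neg]

theorem cov_self_nonneg {l : E → ℝ} (hl : ∀ e, 0 ≤ l e) (hl1 : ∑ e, l e = 1) {f : E → ℝ → ℝ}
    (hf : ∀ e, Continuous (f e)) : 0 ≤ cov l f f := by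
  obtain ⟨m, hm⟩ := exists_cov_self_eq hl1 hf
  rw [hm]
  exact Finset.sum_nonneg fun e _ => intervalIntegral.integral_nonneg (hl e)
    fun x _ => sq_nonneg _

theorem cov_self_le_sq {l : E → ℝ} (hl : ∀ e, 0 ≤ l e) (hl1 : ∑ e, l e = 1) {f : E → ℝ → ℝ}
    (hf : ∀ e, Continuous (f e)) {M : ℝ} (hM : ∀ e, ∀ x ∈ Icc 0 (l e), |f e x| ≤ M) :
    cov l f f ≤ M ^ 2 := by
  refine (cov_self_le_sum l f).trans ?_
  have : ∀ e, ∫ x in (0 : ℝ)..l e, f e x ^ 2 ≤ l e * M ^ 2 := fun e => by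
    have h : ∫ x in (0 : ℝ)..l e, f e x ^ 2 ≤ ∫ _ in (0 : ℝ)..l e, M ^ 2 :=
      intervalIntegral.integral_mono_on (hl e) (((hf e).pow 2).intervalIntegrable _ _)
        (continuous_const.intervalIntegrable _ _) fun x hx => by
          rw [← sq_abs]; exact pow_le_pow_left₀ (abs_nonneg _) (hM e x hx) 2
    simpa using h
  calc ∑ e, ∫ x in (0 : ℝ)..l e, f e x ^ 2
    _ ≤ ∑ e, l e * M ^ 2 := Finset.sum_le_sum fun e _ => this e
    _ = M ^ 2 := by rw [← Finset.sum_mul, hl1, one_mul]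

end Covariance

/-! ### Functions of Sobolev class `H¹` on a metric graph -/

section Admissible

variable {α E : Type*} (s t : E → α) (l : E → ℝ)

/-- The coboundary: the difference of a vertex function along each edge. -/
def edgeDiff : (α → ℝ) →ₗ[ℝ] (E → ℝ) :=
  LinearMap.pi fun e => LinearMap.proj (R := ℝ) (φ := fun _ : α => ℝ) (t e) -
    LinearMap.proj (R := ℝ) (φ := fun _ : α => ℝ) (s e)

@[simp] theorem edgeDiff_apply (φ : α → ℝ) (e : E) : edgeDiff s t φ e = φ (t e) - φ (s e) := rfl

/-- The total increment `∫₀ˡ g` along each edge. -/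
noncomputable def increment : PiLp 2 (fun e => IntervalL2 (l e)) →L[ℝ] (E → ℝ) :=
  ContinuousLinearMap.pi fun e =>
    (primitive (l e) (l e)).comp (PiLp.proj 2 (fun e => IntervalL2 (l e)) e)

@[simp] theorem increment_apply (g : PiLp 2 (fun e => IntervalL2 (l e))) (e : E) :
    increment l g e = primitive (l e) (l e) (g e) := rfl

/-- The derivatives of the continuous functions of Sobolev class `H¹` on the metric graph: square
integrable functions on the edges whose increments come from a function on the vertices. -/
noncomputable def admissible : Submodule ℝ (PiLp 2 (fun e => IntervalL2 (l e))) :=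
  (LinearMap.range (edgeDiff s t)).comap (increment l).toLinearMap

variable [Fintype E]

instance : CompleteSpace (admissible s t l) := by
  have h : IsClosed ((admissible s t l : Submodule ℝ (PiLp 2 (fun e => IntervalL2 (l e)))) :
      Set (PiLp 2 (fun e => IntervalL2 (l e)))) :=
    (Submodule.closed_of_finiteDimensional (LinearMap.range (edgeDiff s t))).preimage
      (increment l).continuous
  exact h.completeSpace_coe

/-- The values at the vertices of an antiderivative of `g` can be chosen linearly in `g`, with a
bound in terms of the norm of `g`. -/
theorem exists_potential (l : E → ℝ) : ∃ (pot : admissible s t l →ₗ[ℝ] (α → ℝ)) (C : ℝ), 0 ≤ C ∧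
    (∀ g e, pot g (t e) - pot g (s e) = primitive (l e) (l e) (g.1 e)) ∧
    ∀ g e, |pot g (s e)| ≤ C * ‖g‖ := by
  obtain ⟨σ, hσ⟩ := LinearMap.exists_rightInverse_of_surjective (edgeDiff s t).rangeRestrict
    (LinearMap.range_rangeRestrict _)
  let I : admissible s t l →ₗ[ℝ] LinearMap.range (edgeDiff s t) :=
    ((increment l).toLinearMap.domRestrict _).codRestrict _ fun g => g.2
  let A : LinearMap.range (edgeDiff s t) →L[ℝ] (E → ℝ) :=
    LinearMap.toContinuousLinearMap (LinearMap.pi fun e => LinearMap.proj (s e) ∘ₗ σ)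
  refine ⟨σ ∘ₗ I, ‖A‖ * ‖increment l‖, by positivity, fun g e => ?_, fun g e => ?_⟩
  · have h := congrArg Subtype.val (LinearMap.congr_fun hσ (I g))
    exact congrFun h e
  · have h1 : ‖A (I g)‖ ≤ ‖A‖ * (‖increment l‖ * ‖g‖) :=
      (A.le_opNorm _).trans (by gcongr; exact (increment l).le_opNorm _)
    calc |σ (I g) (s e)| = ‖A (I g) e‖ := rfl
      _ ≤ ‖A (I g)‖ := norm_le_pi_norm _ e
      _ ≤ _ := by rw [mul_assoc]; exact h1

end Admissible

/-! ### The variance as a compact quadratic form of the derivative -/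

section Energy

variable {α E : Type*} {s t : E → α} {l : E → ℝ}

/-- The function on the metric graph with derivative `g`, normalized by the choice `pot` of its
values at the vertices. -/
noncomputable def antideriv (pot : admissible s t l →ₗ[ℝ] (α → ℝ)) (g : admissible s t l) (e : E)
    (x : ℝ) : ℝ :=
  pot g (s e) + primitive (l e) x (g.1 e)

theorem continuous_antideriv (pot : admissible s t l →ₗ[ℝ] (α → ℝ)) (g : admissible s t l)
    (e : E) : Continuous (antideriv pot g e) :=
  continuous_const.add (continuous_primitive _ _)

theorem antideriv_add (pot : admissible s t l →ₗ[ℝ] (α → ℝ)) (g h : admissible s t l) :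
    antideriv pot (g + h) = fun e x => antideriv pot g e x + antideriv pot h e x := by
  funext e x
  simp only [antideriv, map_add, Pi.add_apply, Submodule.coe_add, PiLp.add_apply]
  ring

theorem antideriv_smul (pot : admissible s t l →ₗ[ℝ] (α → ℝ)) (c : ℝ) (g : admissible s t l) :
    antideriv pot (c • g) = fun e x => c * antideriv pot g e x := by
  funext e x
  simp only [antideriv, map_smul, Pi.smul_apply, Submodule.coe_smul, PiLp.smul_apply, smul_eq_mul]
  ring

theorem antideriv_sub (pot : admissible s t l →ₗ[ℝ] (α → ℝ)) (g h : admissible s t l) :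
    antideriv pot (g - h) = fun e x => antideriv pot g e x - antideriv pot h e x := by
  funext e x
  simp only [antideriv, map_sub, Pi.sub_apply, Submodule.coe_sub, PiLp.sub_apply]
  ring

/-- The family `f` of continuously differentiable functions on the edges (with derivatives `f'`) is
continuous at the vertices, with the values `φ`. -/
def IsTest (s t : E → α) (l : E → ℝ) (φ : α → ℝ) (f f' : E → ℝ → ℝ) : Prop :=
  ∀ e, (∀ x, HasDerivAt (f e) (f' e x) x) ∧ Continuous (f' e) ∧ f e 0 = φ (s e) ∧
    f e (l e) = φ (t e)

theorem IsTest.continuous {φ : α → ℝ} {f f' : E → ℝ → ℝ} (h : IsTest s t l φ f f') (e : E) :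
    Continuous (f e) :=
  continuous_iff_continuousAt.2 fun x => ((h e).1 x).continuousAt

/-- The graph with edge ends `s` and `t` is connected, up to isolated vertices: a function on the
vertices that is constant along each edge is constant on the ends of edges. -/
def EndsConnected (s t : E → α) : Prop :=
  ∀ φ : α → ℝ, (∀ e, φ (s e) = φ (t e)) → ∀ e e', φ (s e) = φ (s e')

variable [Fintype E]

/-- The covariance of the antiderivatives as a bilinear form. -/
noncomputable def covForm (pot : admissible s t l →ₗ[ℝ] (α → ℝ)) :
    admissible s t l →ₗ[ℝ] admissible s t l →ₗ[ℝ] ℝ :=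
  LinearMap.mk₂ ℝ (fun g h => cov l (antideriv pot g) (antideriv pot h))
    (fun g g' h => by
      rw [antideriv_add]
      exact cov_add_left l (continuous_antideriv pot g) (continuous_antideriv pot g')
        (continuous_antideriv pot h))
    (fun c g h => by rw [antideriv_smul, cov_smul_left, smul_eq_mul])
    (fun h g g' => by
      rw [antideriv_add, cov_comm, cov_add_left l (continuous_antideriv pot g)
        (continuous_antideriv pot g') (continuous_antideriv pot h), cov_comm, cov_comm l _
        (antideriv pot h)])
    (fun c h g => by rw [antideriv_smul, cov_comm, cov_smul_left, smul_eq_mul, cov_comm])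

theorem covForm_apply (pot : admissible s t l →ₗ[ℝ] (α → ℝ)) (g h : admissible s t l) :
    covForm pot g h = cov l (antideriv pot g) (antideriv pot h) := rfl

theorem norm_edge_le (g : admissible s t l) (e : E) : ‖g.1 e‖ ≤ ‖g‖ :=
  PiLp.norm_apply_le g.1 e

theorem abs_antideriv_le {pot : admissible s t l →ₗ[ℝ] (α → ℝ)} {C : ℝ}
    (hC : ∀ g e, |pot g (s e)| ≤ C * ‖g‖) (g : admissible s t l) (e : E) {x : ℝ} (h0 : 0 ≤ x)
    (h1 : x ≤ 1) : |antideriv pot g e x| ≤ (C + 1) * ‖g‖ := by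
  have h2 := abs_primitive_le (l e) h0 h1 (g.1 e)
  have h3 := hC g e
  have h4 := norm_edge_le g e
  have h5 := abs_add_le (pot g (s e)) (primitive (l e) x (g.1 e))
  rw [antideriv]; linarith

theorem length_le_one (hl : ∀ e, 0 ≤ l e) (hl1 : ∑ e, l e = 1) (e : E) : l e ≤ 1 :=
  hl1 ▸ Finset.single_le_sum (fun e _ => hl e) (Finset.mem_univ e)

/-- Compactness of the embedding of `H¹` into the continuous functions, by the theorem of Arzelà and
Ascoli. The edges are at most `1` long, so the antiderivatives are compared on `[0, 1]`, where
`primitive (l e)` is constant beyond `l e`. -/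
theorem exists_subseq_covForm (hl : ∀ e, 0 ≤ l e) (hl1 : ∑ e, l e = 1)
    {pot : admissible s t l →ₗ[ℝ] (α → ℝ)} {C : ℝ} (hC0 : 0 ≤ C)
    (hC : ∀ g e, |pot g (s e)| ≤ C * ‖g‖) (g : ℕ → admissible s t l) (hg : ∀ n, ‖g n‖ ≤ 1) :
    ∃ σ : ℕ → ℕ, StrictMono σ ∧ ∀ ε > 0, ∃ N, ∀ m ≥ N, ∀ n ≥ N,
      covForm pot (g (σ m) - g (σ n)) (g (σ m) - g (σ n)) < ε := by
  let F : ℕ → BoundedContinuousFunction (Icc (0 : ℝ) 1) (E → ℝ) := fun n =>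
    BoundedContinuousFunction.mkOfCompact ⟨fun x e => antideriv pot (g n) e x,
      continuous_pi fun e => (continuous_antideriv pot (g n) e).comp continuous_subtype_val⟩
  have hFapp : ∀ n x e, F n x e = antideriv pot (g n) e x := fun _ _ _ => rfl
  have hcomp : IsCompact (closure (range F)) := by
    refine BoundedContinuousFunction.arzela_ascoli (Metric.closedBall (0 : E → ℝ) (C + 1))
      (isCompact_closedBall _ _) _ ?_ ?_
    · rintro _ x ⟨n, rfl⟩
      rw [mem_closedBall_zero_iff, pi_norm_le_iff_of_nonneg (by positivity)]
      intro e
      rw [hFapp, Real.norm_eq_abs]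
      refine (abs_antideriv_le hC (g n) e x.2.1 x.2.2).trans ?_
      nlinarith [hg n]
    · refine Metric.equicontinuous_of_continuity_modulus (fun r => √r) ?_ _ ?_
      · simpa using Real.continuous_sqrt.tendsto 0
      · rintro x y ⟨_, n, rfl⟩
        refine (dist_pi_le_iff (Real.sqrt_nonneg _)).2 fun e => ?_
        change dist (F n x e) (F n y e) ≤ _
        rw [hFapp, hFapp, Real.dist_eq, Subtype.dist_eq, Real.dist_eq, antideriv, antideriv,
          add_sub_add_left_eq_sub]
        refine (abs_primitive_sub_le' (l e) x y _).trans ?_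
        have := (norm_edge_le (g n) e).trans (hg n)
        nlinarith [Real.sqrt_nonneg |(x : ℝ) - y|]
  obtain ⟨a, -, σ, hσ, hlim⟩ := hcomp.tendsto_subseq (x := F)
    (fun n => subset_closure (mem_range_self n))
  refine ⟨σ, hσ, fun ε hε => ?_⟩
  obtain ⟨N, hN⟩ := Metric.cauchySeq_iff.1 hlim.cauchySeq (√(ε / 2)) (by positivity)
  refine ⟨N, fun m hm n hn => ?_⟩
  have hd := (hN m hm n hn).le
  rw [covForm_apply]
  refine (cov_self_le_sq hl hl1 (continuous_antideriv pot _) (M := √(ε / 2)) ?_).trans_lt ?_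
  · intro e x hx
    have hx1 : x ∈ Icc (0 : ℝ) 1 := ⟨hx.1, hx.2.trans (length_le_one hl hl1 e)⟩
    rw [antideriv_sub]
    have h1 := (BoundedContinuousFunction.dist_coe_le_dist (f := F (σ m)) (g := F (σ n))
      ⟨x, hx1⟩).trans hd
    exact (dist_le_pi_dist (F (σ m) ⟨x, hx1⟩) (F (σ n) ⟨x, hx1⟩) e).trans h1
  · rw [Real.sq_sqrt (by positivity)]; linarith

/-- A test function is, up to a constant, the antiderivative of an admissible function. -/
theorem IsTest.exists_admissible (hl : ∀ e, 0 ≤ l e) (hconn : EndsConnected s t)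
    {pot : admissible s t l →ₗ[ℝ] (α → ℝ)}
    (hpot : ∀ g e, pot g (t e) - pot g (s e) = primitive (l e) (l e) (g.1 e))
    {φ : α → ℝ} {f f' : E → ℝ → ℝ} (h : IsTest s t l φ f f') :
    ∃ (a : admissible s t l) (c : ℝ),
      (∀ e, ∀ x ∈ Icc 0 (l e), antideriv pot a e x = f e x + c) ∧
      (∀ e, a.1 e =ᵐ[volume.restrict (Ioc 0 (l e))] f' e) ∧
      ∀ g : admissible s t l, inner ℝ g a = ∑ e, ∫ x in (0 : ℝ)..l e, g.1 e x * f' e x := by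
  let a₀ : PiLp 2 (fun e => IntervalL2 (l e)) :=
    WithLp.toLp 2 fun e => IntervalL2.ofContinuous (l e) (f' e) (h e).2.1
  have ha₀ : ∀ e, ∀ x ∈ Icc 0 (l e), primitive (l e) x (a₀ e) = f e x - f e 0 := by
    intro e x hx
    rw [primitive_eq_intervalIntegral hx]
    rw [IntervalL2.intervalIntegral_congr hx
      (IntervalL2.coeFn_ofContinuous (l e) (f' e) (h e).2.1)]
    exact intervalIntegral.integral_eq_sub_of_hasDerivAt (fun y _ => (h e).1 y)
      ((h e).2.1.intervalIntegrable _ _)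
  have hinc : ∀ e, φ (t e) - φ (s e) = primitive (l e) (l e) (a₀ e) := fun e => by
    rw [ha₀ e (l e) ⟨hl e, le_rfl⟩, (h e).2.2.1, (h e).2.2.2]
  let a : admissible s t l := ⟨a₀, φ, by funext e; exact hinc e⟩
  have hdiff : ∀ e e', (pot a - φ) (s e) = (pot a - φ) (s e') := by
    refine hconn (pot a - φ) fun e => ?_
    have h1 := hpot a e
    have h2 := hinc e
    simp only [Pi.sub_apply]
    have h3 : primitive (l e) (l e) (a.1 e) = primitive (l e) (l e) (a₀ e) := rfl
    linarith
  obtain ⟨c, hc⟩ : ∃ c, ∀ e, pot a (s e) = φ (s e) + c := by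
    rcases isEmpty_or_nonempty E with hE | ⟨⟨e₀⟩⟩
    · exact ⟨0, fun e => hE.elim e⟩
    · refine ⟨(pot a - φ) (s e₀), fun e => ?_⟩
      have := hdiff e e₀
      simp only [Pi.sub_apply] at this ⊢
      linarith
  refine ⟨a, c, fun e x hx => ?_,
    fun e => IntervalL2.coeFn_ofContinuous (l e) (f' e) (h e).2.1, fun g => ?_⟩
  · have h3 : primitive (l e) x (a.1 e) = primitive (l e) x (a₀ e) := rfl
    rw [antideriv, hc, h3, ha₀ e x hx, (h e).2.2.1]
    ring
  · rw [Submodule.coe_inner, PiLp.inner_apply]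
    refine Finset.sum_congr rfl fun e _ => ?_
    exact IntervalL2.inner_ofContinuous (hl e) (g.1 e) (f' e) (h e).2.1

theorem IsTest.covForm_self (hl : ∀ e, 0 ≤ l e) (hl1 : ∑ e, l e = 1)
    {pot : admissible s t l →ₗ[ℝ] (α → ℝ)} {φ : α → ℝ} {f f' : E → ℝ → ℝ}
    (h : IsTest s t l φ f f') {a : admissible s t l} {c : ℝ}
    (ha : ∀ e, ∀ x ∈ Icc 0 (l e), antideriv pot a e x = f e x + c) :
    covForm pot a a = cov l f f := by
  rw [covForm_apply, cov_congr hl (f' := fun e x => f e x + c) (h' := fun e x => f e x + c) ha ha]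
  exact cov_add_const hl1 h.continuous h.continuous c c

end Energy

/-! ### Eigenfunctions and the Poincaré inequality -/

/-- The solution of `u'' = -k² u` with `u 0 = A` and `u' 0 = k B`. -/
noncomputable def wave (k A B x : ℝ) : ℝ := A * Real.cos (k * x) + B * Real.sin (k * x)

/-- The derivative of `wave`. -/
noncomputable def waveDeriv (k A B x : ℝ) : ℝ :=
  k * (B * Real.cos (k * x) - A * Real.sin (k * x))

theorem hasDerivAt_wave (k A B x : ℝ) : HasDerivAt (wave k A B) (waveDeriv k A B x) x := by
  have := ((hasDerivAt_cos_mul k x).const_mul A).add ((hasDerivAt_sin_mul k x).const_mul B)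
  refine (show HasDerivAt (wave k A B) _ x from this).congr_deriv ?_
  rw [waveDeriv]; ring

theorem hasDerivAt_waveDeriv (k A B x : ℝ) :
    HasDerivAt (waveDeriv k A B) (-(k ^ 2 * wave k A B x)) x := by
  have := (((hasDerivAt_cos_mul k x).const_mul B).sub
    ((hasDerivAt_sin_mul k x).const_mul A)).const_mul k
  refine (show HasDerivAt (waveDeriv k A B) _ x from this).congr_deriv ?_
  rw [wave]; ring

@[fun_prop] theorem continuous_wave (k A B : ℝ) : Continuous (wave k A B) := by
  unfold wave; fun_prop

@[fun_prop] theorem continuous_waveDeriv (k A B : ℝ) : Continuous (waveDeriv k A B) := by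
  unfold waveDeriv; fun_prop

@[simp] theorem wave_zero (k A B : ℝ) : wave k A B 0 = A := by simp [wave]

@[simp] theorem waveDeriv_zero (k A B : ℝ) : waveDeriv k A B 0 = k * B := by simp [waveDeriv]

section Eigen

variable {α E : Type*} [Fintype E]

/-- The functions `wave k (φ (s e)) (b e)` on the edges form an eigenfunction with eigenvalue `k²`
for the lengths `l`, where edges of length zero are contracted. The Kirchhoff condition is stated
in weak form: it is tested against vertex functions that are constant along contracted edges. -/
structure IsEigenfunction (s t : E → α) (l : E → ℝ) (k : ℝ) (φ : α → ℝ) (b : E → ℝ) : Prop where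
  match_end : ∀ e, wave k (φ (s e)) (b e) (l e) = φ (t e)
  kirchhoff : ∀ ψ : α → ℝ, (∀ e, l e = 0 → ψ (s e) = ψ (t e)) →
    ∑ e, (waveDeriv k (φ (s e)) (b e) (l e) * ψ (t e) - k * b e * ψ (s e)) = 0
  nontrivial : ∃ e, 0 < l e ∧ (φ (s e) ≠ 0 ∨ b e ≠ 0)

/-- The Poincaré inequality `k² Var f ≤ ∫ |f'|²`. -/
def Poincare (s t : E → α) (l : E → ℝ) (k : ℝ) : Prop :=
  ∀ (φ : α → ℝ) (f f' : E → ℝ → ℝ), IsTest s t l φ f f' →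
    k ^ 2 * cov l f f ≤ ∑ e, ∫ x in (0 : ℝ)..l e, f' e x ^ 2

variable {s t : E → α} {l : E → ℝ}

/-- A full period of the sine on a single edge is a nonconstant test function. -/
theorem exists_test_cov_pos (hl1 : ∑ e, l e = 1) :
    ∃ (φ : α → ℝ) (f f' : E → ℝ → ℝ), IsTest s t l φ f f' ∧ 0 < cov l f f := by
  classical
  obtain ⟨e₀, he₀⟩ : ∃ e, 0 < l e := by
    by_contra! hcon
    have : ∑ e, l e ≤ 0 := Finset.sum_nonpos fun e _ => hcon e
    linarith
  have hk : 0 < 2 * Real.pi / l e₀ := by positivity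
  set k := 2 * Real.pi / l e₀ with hkdef
  have hkl : k * l e₀ = 2 * Real.pi := by rw [hkdef]; field_simp
  refine ⟨0, fun e x => if e = e₀ then wave k 0 1 x else 0,
    fun e x => if e = e₀ then waveDeriv k 0 1 x else 0, fun e => ?_, ?_⟩
  · by_cases he : e = e₀
    · subst he
      simp only [if_true]
      exact ⟨hasDerivAt_wave k 0 1, by fun_prop, by simp, by simp [wave, hkl]⟩
    · simp only [if_neg he]
      exact ⟨fun x => hasDerivAt_const x 0, continuous_const, by simp, by simp⟩
  · have h1 : ∀ F : ℝ → ℝ, ∑ e, (∫ x in (0 : ℝ)..l e, if e = e₀ then F x else 0) =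
        ∫ x in (0 : ℝ)..l e₀, F x := fun F => by
      rw [Finset.sum_eq_single e₀ (fun e _ he => by simp [he]) (by simp)]
      simp
    have h2 : ∫ x in (0 : ℝ)..l e₀, wave k 0 1 x = 0 := by
      have h := intervalIntegral.integral_eq_sub_of_hasDerivAt (a := 0) (b := l e₀)
        (fun x _ => hasDerivAt_waveDeriv k 0 1 x)
        (Continuous.intervalIntegrable (by fun_prop) _ _)
      rw [intervalIntegral.integral_neg, intervalIntegral.integral_const_mul] at h
      simp only [waveDeriv, hkl, Real.cos_two_pi, mul_zero, Real.cos_zero, zero_mul, sub_zero,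
        sub_self, neg_eq_zero, mul_eq_zero, pow_eq_zero_iff two_ne_zero] at h
      exact h.resolve_left hk.ne'
    have h3 : ∀ e x, ((if e = e₀ then wave k 0 1 x else 0) *
        if e = e₀ then wave k 0 1 x else 0) =
        if e = e₀ then wave k 0 1 x * wave k 0 1 x else 0 := fun e x => by
      split_ifs <;> simp
    simp only [cov, h3, h1, h2, mul_zero, sub_zero]
    refine intervalIntegral.integral_pos he₀ (Continuous.continuousOn (by fun_prop))
      (fun x _ => mul_self_nonneg _) ⟨l e₀ / 4, ⟨by positivity, by linarith⟩, ?_⟩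
    have : k * (l e₀ / 4) = Real.pi / 2 := by linarith
    simp [wave, this]

/-- The least positive eigenvalue exists, and it is the optimal constant in the Poincaré
inequality. -/
theorem exists_isEigenfunction_poincare (hl : ∀ e, 0 ≤ l e) (hl1 : ∑ e, l e = 1)
    (hconn : EndsConnected s t) :
    ∃ (k : ℝ) (φ : α → ℝ) (b : E → ℝ), 0 < k ∧ IsEigenfunction s t l k φ b ∧
      Poincare s t l k := by
  obtain ⟨pot, C, hC0, hpot, hC⟩ := exists_potential s t l
  obtain ⟨g, μ, hμ, hg0, hweak, hmax⟩ := exists_maximizer_of_compact_form (covForm pot)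
    (fun g h => by rw [covForm_apply, covForm_apply, cov_comm])
    (fun g => cov_self_nonneg hl hl1 (continuous_antideriv pot g)) ((C + 1) ^ 2)
    (fun g => by
      rw [← mul_pow, covForm_apply]
      exact cov_self_le_sq hl hl1 (continuous_antideriv pot g) fun e x hx =>
        abs_antideriv_le hC g e hx.1 (hx.2.trans (length_le_one hl hl1 e)))
    (exists_subseq_covForm hl hl1 hC0 hC)
    (by
      obtain ⟨φ, f, f', hf, hpos⟩ := exists_test_cov_pos (s := s) (t := t) hl1
      obtain ⟨a, c, ha, -⟩ := hf.exists_admissible hl hconn hpot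
      exact ⟨a, by rwa [hf.covForm_self hl hl1 ha]⟩)
  set k := √(μ⁻¹) with hk
  have hkpos : 0 < k := Real.sqrt_pos.2 (inv_pos.2 hμ)
  have hk2 : k ^ 2 = μ⁻¹ := Real.sq_sqrt (inv_pos.2 hμ).le
  -- the centered eigenfunction
  set m := ∑ e, ∫ x in (0 : ℝ)..l e, antideriv pot g e x with hm
  set F : E → ℝ → ℝ := fun e x => antideriv pot g e x + -m with hF
  have hFc : ∀ e, Continuous (F e) := fun e => (continuous_antideriv pot g e).add continuous_const
  have hF0 : ∑ e, ∫ x in (0 : ℝ)..l e, F e x = 0 := by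
    have : ∀ e, ∫ x in (0 : ℝ)..l e, F e x =
        (∫ x in (0 : ℝ)..l e, antideriv pot g e x) + l e * -m := fun e => by
      rw [hF, intervalIntegral.integral_add ((continuous_antideriv pot g e).intervalIntegrable _ _)
        (continuous_const.intervalIntegrable _ _)]
      simp
    simp only [this, Finset.sum_add_distrib, ← Finset.sum_mul, hl1, ← hm]
    ring
  have hcovF : ∀ h : admissible s t l, μ * inner ℝ g h = cov l F (antideriv pot h) := fun h => by
    rw [← hweak h, covForm_apply]
    have := cov_add_const hl1 (continuous_antideriv pot g) (continuous_antideriv pot h) (-m) 0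
    simpa using this.symm
  have hcovF' : ∀ ψ, cov l F ψ = ∑ e, ∫ x in (0 : ℝ)..l e, F e x * ψ e x := fun ψ => by
    rw [cov, hF0, zero_mul, sub_zero]
  -- the weak equation on a single edge
  have hedge : ∀ e, ∃ c : ℝ, g.1 e =ᵐ[volume.restrict (Ioc 0 (l e))]
      fun x => μ⁻¹ * (c - ∫ t in (0 : ℝ)..x, F e t) := by
    intro e
    refine ae_eq_of_weak_equation (hl e) hμ.ne' (F e) (hFc e) (g.1 e) fun h hh => ?_
    classical
    let a₀ : PiLp 2 (fun e => IntervalL2 (l e)) := WithLp.toLp 2 (Pi.single e h)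
    have ha₀ : ∀ e' ≠ e, a₀ e' = 0 := fun e' he' =>
      Pi.single_eq_of_ne (M := fun e => IntervalL2 (l e)) he' h
    have hae : a₀ e = h := Pi.single_eq_same (M := fun e => IntervalL2 (l e)) e h
    have hinc : ∀ e', primitive (l e') (l e') (a₀ e') = 0 := fun e' => by
      by_cases he' : e' = e
      · subst he'; rw [hae, hh]
      · rw [ha₀ e' he', map_zero]
    let a : admissible s t l := ⟨a₀, 0, by funext e'; simpa using (hinc e').symm⟩
    have hpa : ∀ e', pot a (s e') = pot a (s e) := fun e' =>
      hconn (pot a) (fun e => by have := hpot a e; rw [show a.1 e = a₀ e from rfl, hinc] at this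
                                 linarith) e' e
    have h1 := hcovF a
    have h2 : antideriv pot a = fun e' x => primitive (l e') x (a₀ e') + pot a (s e) := by
      funext e' x; rw [antideriv, hpa e', add_comm]
    have h3 := cov_add_const hl1 hFc (h := fun e' x => primitive (l e') x (a₀ e'))
      (fun e' => continuous_primitive _ _) 0 (pot a (s e))
    simp only [add_zero] at h3
    rw [h2, h3, hcovF', Finset.sum_eq_single e (fun e' _ he' => by simp [ha₀ e' he']) (by simp),
      hae, Submodule.coe_inner, PiLp.inner_apply, Finset.sum_eq_single e
        (fun e' _ he' => by rw [show a.1 e' = a₀ e' from rfl, ha₀ e' he', inner_zero_right])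
        (by simp), show a.1 e = h from hae] at h1
    exact h1.symm
  choose c hc using hedge
  have hwave : ∀ e, ∀ x ∈ Icc 0 (l e), F e x = wave k (F e 0) (k * c e) x ∧
      k ^ 2 * (c e - ∫ t in (0 : ℝ)..x, F e t) = waveDeriv k (F e 0) (k * c e) x := by
    intro e x hx
    have h := eq_cos_add_sin_of_integral_eq (hl e) hkpos (f := F e)
      (f' := fun x => k ^ 2 * (c e - ∫ t in (0 : ℝ)..x, F e t)) (hFc e).continuousOn
      (fun x hx => by simp; ring) (fun x hx => ?_) hx
    · simp only [intervalIntegral.integral_same, sub_zero, smul_eq_mul] at h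
      rw [h.1, h.2, wave, waveDeriv]
      constructor <;> (field_simp; try ring)
    · rw [← IntervalL2.intervalIntegral_congr hx (hk2 ▸ hc e), ← primitive_eq_intervalIntegral hx]
      simp only [hF, antideriv, primitive_zero]
      ring
  have hmatch : ∀ e, F e (l e) = pot g (t e) - m := fun e => by
    simp only [hF, antideriv, ← hpot g e]; ring
  have hstart : ∀ e, F e 0 = pot g (s e) - m := fun e => by
    simp only [hF, antideriv, primitive_zero]; ring
  have hgw : ∀ e, g.1 e =ᵐ[volume.restrict (Ioc 0 (l e))] waveDeriv k (F e 0) (k * c e) :=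
    fun e => by
      filter_upwards [hc e, ae_restrict_mem measurableSet_Ioc] with x hx hxm
      rw [hx, ← hk2, (hwave e x (Ioc_subset_Icc_self hxm)).2]
  refine ⟨k, fun v => pot g v - m, fun e => k * c e, hkpos, ⟨fun e => ?_, fun ψ hψ => ?_, ?_⟩, ?_⟩
  · rw [← hstart, ← hmatch, ← (hwave e (l e) ⟨hl e, le_rfl⟩).1]
  · -- test the weak equation against the edgewise affine extension of `ψ`
    set d : E → ℝ := fun e => (ψ (t e) - ψ (s e)) / l e with hd
    have hdl : ∀ e, d e * l e = ψ (t e) - ψ (s e) := fun e => by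
      -- on edges of length zero, `d e = 0` by the convention for division by zero
      by_cases h : l e = 0
      · rw [h, hψ e h]; simp
      · rw [hd]; field_simp
    have htest : IsTest s t l ψ (fun e x => ψ (s e) + d e * x) (fun e _ => d e) := fun e =>
      ⟨fun x => by simpa using ((hasDerivAt_id x).const_mul (d e)).const_add (ψ (s e)),
        continuous_const, by simp, by simp [hdl]⟩
    obtain ⟨a, c', ha, -, hinner⟩ := htest.exists_admissible hl hconn hpot
    have h1 := hcovF a
    rw [hinner g, cov_congr hl (fun _ _ _ => rfl)
      (h' := fun e x => (ψ (s e) + d e * x) + c') ha] at h1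
    have h2 := cov_add_const hl1 hFc htest.continuous 0 c'
    simp only [add_zero] at h2
    rw [h2, hcovF'] at h1
    have h3 : ∀ e, ∫ x in (0 : ℝ)..l e, g.1 e x * d e =
        ∫ x in (0 : ℝ)..l e, waveDeriv k (F e 0) (k * c e) x * d e := fun e => by
      refine IntervalL2.intervalIntegral_congr ⟨hl e, le_rfl⟩ ?_
      filter_upwards [hgw e] with x hx
      rw [hx]
    have h4 : ∀ e, ∫ x in (0 : ℝ)..l e, F e x * (ψ (s e) + d e * x) =
        ∫ x in (0 : ℝ)..l e, wave k (F e 0) (k * c e) x * (ψ (s e) + d e * x) := fun e => by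
      refine intervalIntegral.integral_congr fun x hx => ?_
      rw [uIcc_of_le (hl e)] at hx
      simp only [← (hwave e x hx).1]
    have h5 : ∀ e, waveDeriv k (F e 0) (k * c e) (l e) * ψ (t e) - k * (k * c e) * ψ (s e) =
        (∫ x in (0 : ℝ)..l e, g.1 e x * d e) -
          k ^ 2 * ∫ x in (0 : ℝ)..l e, F e x * (ψ (s e) + d e * x) := fun e => by
      rw [h3, h4, ← intervalIntegral.integral_const_mul, ← intervalIntegral.integral_sub
        (Continuous.intervalIntegrable (by fun_prop) _ _)
        (Continuous.intervalIntegrable (by fun_prop) _ _)]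
      rw [intervalIntegral.integral_eq_sub_of_hasDerivAt
        (f := fun x => waveDeriv k (F e 0) (k * c e) x * (ψ (s e) + d e * x)) (fun x _ => ?_)
        (Continuous.intervalIntegrable (by fun_prop) _ _)]
      · simp [hdl]
      · have := (hasDerivAt_waveDeriv k (F e 0) (k * c e) x).mul ((htest e).1 x)
        refine this.congr_deriv ?_
        ring
    simp only [← hstart, h5, Finset.sum_sub_distrib, ← Finset.mul_sum, ← h1, hk2]
    field_simp
    ring
  · by_contra! hcon
    refine hg0 ?_
    have hz : ∀ e, g.1 e = 0 := fun e => by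
      refine Lp.ext ?_
      rcases (hl e).eq_or_lt with h | h
      · have h0 : volume.restrict (Ioc 0 (l e)) = 0 := by rw [← h]; simp
        rw [EventuallyEq, ae_eq_bot.2 h0]
        exact eventually_bot
      · filter_upwards [hgw e, Lp.coeFn_zero ℝ 2 (volume.restrict (Ioc 0 (l e)))] with x hx hx0
        have h2 := hcon e h
        simp only [← hstart] at h2
        rw [hx, hx0, h2.1, h2.2]
        simp [waveDeriv]
    ext1
    exact PiLp.ext hz
  · intro φ f f' hf
    obtain ⟨a, c', ha, hae, hinner⟩ := hf.exists_admissible hl hconn hpot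
    have h1 := hmax a
    rw [hf.covForm_self hl hl1 ha, ← real_inner_self_eq_norm_sq, hinner a] at h1
    have h2 : ∀ e, ∫ x in (0 : ℝ)..l e, a.1 e x * f' e x = ∫ x in (0 : ℝ)..l e, f' e x ^ 2 :=
      fun e => by
        refine IntervalL2.intervalIntegral_congr ⟨hl e, le_rfl⟩ ?_
        filter_upwards [hae e] with x hx
        rw [hx, sq]
    simp only [h2] at h1
    rw [hk2]
    calc _ ≤ μ⁻¹ * (μ * ∑ e, ∫ x in (0 : ℝ)..l e, f' e x ^ 2) := by gcongr
      _ = _ := by field_simp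

end Eigen

/-! ### Upper semicontinuity of the Poincaré constant -/

theorem exists_wave_ne_zero {k A B l : ℝ} (hk : 0 < k) (hl : 0 < l) (h : A ≠ 0 ∨ B ≠ 0) :
    ∃ x ∈ Icc 0 l, wave k A B x ≠ 0 := by
  by_cases hA : A = 0
  · subst hA
    have hB := h.resolve_left (by simp)
    have hx : 0 < min l (Real.pi / 2 / k) := lt_min hl (by positivity)
    refine ⟨min l (Real.pi / 2 / k), ⟨hx.le, min_le_left _ _⟩, ?_⟩
    have h1 : k * min l (Real.pi / 2 / k) ≤ Real.pi / 2 := by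
      calc k * min l (Real.pi / 2 / k) ≤ k * (Real.pi / 2 / k) := by gcongr; exact min_le_right _ _
        _ = Real.pi / 2 := by field_simp
    have h2 : 0 < Real.sin (k * min l (Real.pi / 2 / k)) :=
      Real.sin_pos_of_pos_of_lt_pi (by positivity) (by linarith [Real.pi_pos])
    simp only [wave, zero_mul, zero_add]
    exact mul_ne_zero hB h2.ne'
  · exact ⟨0, ⟨le_rfl, hl.le⟩, by simpa using hA⟩

section Eigen

variable {α E : Type*} [Fintype E] {s t : E → α} {l : E → ℝ} {k : ℝ} {φ : α → ℝ} {b : E → ℝ}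

theorem IsEigenfunction.sum_integral (hk : 0 < k) (h : IsEigenfunction s t l k φ b) :
    ∑ e, ∫ x in (0 : ℝ)..l e, wave k (φ (s e)) (b e) x = 0 := by
  have h1 := h.kirchhoff (fun _ => 1) (fun _ _ => rfl)
  have h2 : ∀ e, waveDeriv k (φ (s e)) (b e) (l e) * 1 - k * b e * 1 =
      -k ^ 2 * ∫ x in (0 : ℝ)..l e, wave k (φ (s e)) (b e) x := fun e => by
    have := intervalIntegral.integral_eq_sub_of_hasDerivAt (a := 0) (b := l e)
      (fun x _ => hasDerivAt_waveDeriv k (φ (s e)) (b e) x)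
      (Continuous.intervalIntegrable (by fun_prop) _ _)
    rw [intervalIntegral.integral_neg, intervalIntegral.integral_const_mul, waveDeriv_zero] at this
    linarith
  simp only [h2, ← Finset.mul_sum] at h1
  exact (mul_eq_zero.1 h1).resolve_left (by simp [hk.ne'])

theorem IsEigenfunction.sum_integral_deriv_sq (h : IsEigenfunction s t l k φ b) :
    ∑ e, ∫ x in (0 : ℝ)..l e, waveDeriv k (φ (s e)) (b e) x ^ 2 =
      k ^ 2 * ∑ e, ∫ x in (0 : ℝ)..l e, wave k (φ (s e)) (b e) x ^ 2 := by
  have h1 := h.kirchhoff φ (fun e he => by have := h.match_end e; rw [he] at this; simpa using this)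
  have h2 : ∀ e, waveDeriv k (φ (s e)) (b e) (l e) * φ (t e) - k * b e * φ (s e) =
      (∫ x in (0 : ℝ)..l e, waveDeriv k (φ (s e)) (b e) x ^ 2) -
        k ^ 2 * ∫ x in (0 : ℝ)..l e, wave k (φ (s e)) (b e) x ^ 2 := fun e => by
    rw [← intervalIntegral.integral_const_mul, ← intervalIntegral.integral_sub
      (Continuous.intervalIntegrable (by fun_prop) _ _)
      (Continuous.intervalIntegrable (by fun_prop) _ _),
      intervalIntegral.integral_eq_sub_of_hasDerivAt
        (f := fun x => waveDeriv k (φ (s e)) (b e) x * wave k (φ (s e)) (b e) x) (fun x _ => ?_)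
        (Continuous.intervalIntegrable (by fun_prop) _ _)]
    · simp [h.match_end e]
    · refine ((hasDerivAt_waveDeriv k _ _ x).mul (hasDerivAt_wave k _ _ x)).congr_deriv ?_
      ring
  simp only [h2, Finset.sum_sub_distrib, ← Finset.mul_sum] at h1
  linarith

theorem IsEigenfunction.sum_integral_sq_pos (hl : ∀ e, 0 ≤ l e) (hk : 0 < k)
    (h : IsEigenfunction s t l k φ b) :
    0 < ∑ e, ∫ x in (0 : ℝ)..l e, wave k (φ (s e)) (b e) x ^ 2 := by
  obtain ⟨e, he, hne⟩ := h.nontrivial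
  obtain ⟨x, hx, hxne⟩ := exists_wave_ne_zero hk he hne
  refine Finset.sum_pos' (fun e _ => intervalIntegral.integral_nonneg (hl e)
    fun x _ => sq_nonneg _) ⟨e, Finset.mem_univ e, ?_⟩
  exact intervalIntegral.integral_pos he (Continuous.continuousOn (by fun_prop))
    (fun x _ => sq_nonneg _) ⟨x, hx, by positivity⟩

/-- Integrals of a rescaled function depend continuously on the length. For `l = 0` the integrand is
the constant `F 0`. -/
theorem tendsto_integral_comp_scale (F : ℝ → ℝ) (l : ℝ) :
    Tendsto (fun m => ∫ x in (0 : ℝ)..m, F (l / m * x)) (𝓝 l) (𝓝 (∫ x in (0 : ℝ)..l, F x)) := by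
  by_cases hl : l = 0
  · subst hl
    have : Tendsto (fun m : ℝ => m * F 0) (𝓝 0) (𝓝 (0 * F 0)) :=
      Continuous.tendsto (f := fun m : ℝ => m * F 0) (by fun_prop) 0
    simpa using this
  · have h1 : Tendsto (fun m : ℝ => (l / m)⁻¹ * ∫ x in (0 : ℝ)..l, F x) (𝓝 l)
        (𝓝 ((l / l)⁻¹ * ∫ x in (0 : ℝ)..l, F x)) := by
      refine Tendsto.mul_const _ (Tendsto.inv₀ (tendsto_const_nhds.div tendsto_id hl) ?_)
      rw [div_self hl]; exact one_ne_zero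
    rw [div_self hl, inv_one, one_mul] at h1
    refine h1.congr' ?_
    filter_upwards [isOpen_ne.mem_nhds hl] with m hm
    rw [intervalIntegral.integral_comp_mul_left (fun x => F x) (div_ne_zero hl hm), mul_zero,
      div_mul_cancel₀ _ hm, smul_eq_mul]

/-- An eigenfunction for the lengths `l`, rescaled on each edge, is a test function for all lengths
near `l`. This gives the upper semicontinuity of the spectral gap, also where edges are
contracted. -/
theorem IsEigenfunction.eventually_poincare_lt (hl : ∀ e, 0 ≤ l e) (hk : 0 < k)
    (h : IsEigenfunction s t l k φ b) {κ : ℝ} (hκ : k < κ) :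
    ∀ᶠ m in 𝓝 l, ∀ k', Poincare s t m k' → k' < κ := by
  set u : E → ℝ → ℝ := fun e => wave k (φ (s e)) (b e) with hu
  set u' : E → ℝ → ℝ := fun e => waveDeriv k (φ (s e)) (b e) with hu'
  have huc' : ∀ e, Continuous (u' e) := fun e => continuous_waveDeriv _ _ _
  let f : (E → ℝ) → E → ℝ → ℝ := fun m e x => u e (l e / m e * x)
  let f' : (E → ℝ) → E → ℝ → ℝ := fun m e x => l e / m e * u' e (l e / m e * x)
  set N := ∑ e, ∫ x in (0 : ℝ)..l e, u e x ^ 2 with hN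
  have hNpos : 0 < N := h.sum_integral_sq_pos hl hk
  have hev : ∀ e, Tendsto (fun m : E → ℝ => m e) (𝓝 l) (𝓝 (l e)) := fun e =>
    (continuous_apply e).tendsto l
  have hcov : Tendsto (fun m => cov m (f m) (f m)) (𝓝 l) (𝓝 N) := by
    have h1 : Tendsto (fun m => ∑ e, ∫ x in (0 : ℝ)..m e, f m e x * f m e x) (𝓝 l) (𝓝 N) := by
      refine tendsto_finsetSum _ fun e _ => ?_
      have := (tendsto_integral_comp_scale (fun x => u e x ^ 2) (l e)).comp (hev e)
      simpa only [Function.comp_def, sq] using this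
    have h2 : Tendsto (fun m => ∑ e, ∫ x in (0 : ℝ)..m e, f m e x) (𝓝 l) (𝓝 0) := by
      have := tendsto_finsetSum Finset.univ fun e _ =>
        (tendsto_integral_comp_scale (u e) (l e)).comp (hev e)
      rwa [h.sum_integral hk] at this
    simpa [cov] using h1.sub (h2.mul h2)
  have hen : Tendsto (fun m => ∑ e, ∫ x in (0 : ℝ)..m e, f' m e x ^ 2) (𝓝 l) (𝓝 (k ^ 2 * N)) := by
    rw [hN, ← h.sum_integral_deriv_sq]
    refine tendsto_finsetSum _ fun e _ => ?_
    have h1 : ∀ m : E → ℝ, ∫ x in (0 : ℝ)..m e, f' m e x ^ 2 =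
        (l e / m e) ^ 2 * ∫ x in (0 : ℝ)..m e, u' e (l e / m e * x) ^ 2 := fun m => by
      simp only [f', mul_pow, intervalIntegral.integral_const_mul]
    simp only [h1]
    by_cases he : l e = 0
    · simp [he]
    · have h2 : Tendsto (fun m : E → ℝ => (l e / m e) ^ 2) (𝓝 l) (𝓝 ((l e / l e) ^ 2)) :=
        ((tendsto_const_nhds.div (hev e) he).pow 2)
      rw [div_self he, one_pow] at h2
      have h3 := (tendsto_integral_comp_scale (fun x => u' e x ^ 2) (l e)).comp (hev e)
      simpa using h2.mul h3
  have hlt : k ^ 2 * N < κ ^ 2 * N := by gcongr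
  filter_upwards [hcov.eventually (lt_mem_nhds hNpos),
    (hen.eventually_lt (hcov.const_mul (κ ^ 2)) hlt), eventually_all.2 fun e =>
      (show ∀ᶠ m : E → ℝ in 𝓝 l, l e ≠ 0 → m e ≠ 0 by
        by_cases he : l e = 0
        · simp [he]
        · filter_upwards [(hev e).eventually (isOpen_ne.mem_nhds he)] with m hm _ using hm)]
    with m hm1 hm2 hm3 k' hk'
  have htest : IsTest s t m φ (f m) (f' m) := fun e => by
    refine ⟨fun x => ?_, by fun_prop, by simp [f, hu], ?_⟩
    · have := (hasDerivAt_wave k (φ (s e)) (b e) (l e / m e * x)).comp x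
        ((hasDerivAt_id x).const_mul (l e / m e))
      refine (show HasDerivAt (f m e) _ x from this).congr_deriv ?_
      simp only [f', hu']; ring
    · by_cases he : l e = 0
      · have := h.match_end e
        rw [he] at this
        simpa [f, hu, he] using this
      · simp only [f, hu]
        rw [div_mul_cancel₀ _ (hm3 e he), h.match_end e]
  have h4 := (hk' φ _ _ htest).trans_lt hm2
  exact lt_of_pow_lt_pow_left₀ 2 (hk.trans hκ).le (lt_of_mul_lt_mul_right h4 hm1.le)

end Eigen

/-! ### Bridges, and the upper bound for trees -/

section Cuts

variable {α E : Type*} {s t : E → α}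

/-- The vertex `v` is incident to an edge. -/
def IsEnd (s t : E → α) (v : α) : Prop := ∃ e, v = s e ∨ v = t e

theorem isEnd_start (s t : E → α) (e : E) : IsEnd s t (s e) := ⟨e, Or.inl rfl⟩

theorem isEnd_finish (s t : E → α) (e : E) : IsEnd s t (t e) := ⟨e, Or.inr rfl⟩

theorem EndsConnected.eq (hconn : EndsConnected s t) {ψ : α → ℝ} (hψ : ∀ e, ψ (s e) = ψ (t e))
    {v w : α} (hv : IsEnd s t v) (hw : IsEnd s t w) : ψ v = ψ w := by
  obtain ⟨e, he⟩ := hv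
  obtain ⟨e', he'⟩ := hw
  have h1 : ψ v = ψ (s e) := by rcases he with rfl | rfl; exacts [rfl, (hψ e).symm]
  have h2 : ψ w = ψ (s e') := by rcases he' with rfl | rfl; exacts [rfl, (hψ e').symm]
  rw [h1, h2, hconn ψ hψ e e']

/-- The vertex functions `χ e`, for `e` in `N`, are the indicators of one side of the cut formed by
the single edge `e`, which is therefore a bridge. -/
structure IsCutFamily (s t : E → α) (N : Finset E) (χ : E → α → ℝ) : Prop where
  zero_or_one : ∀ e ∈ N, ∀ v, χ e v = 0 ∨ χ e v = 1
  cross : ∀ e ∈ N, χ e (s e) ≠ χ e (t e)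
  const : ∀ e ∈ N, ∀ e', e' ≠ e → χ e (s e') = χ e (t e')

variable {N : Finset E} {χ : E → α → ℝ}

theorem IsCutFamily.sq_diff (h : IsCutFamily s t N χ) {e : E} (he : e ∈ N) :
    (χ e (t e) - χ e (s e)) ^ 2 = 1 := by
  have := h.cross e he
  rcases h.zero_or_one e he (s e) with h1 | h1 <;> rcases h.zero_or_one e he (t e) with h2 | h2 <;>
    simp_all

/-- A vertex function with its jumps along the bridges in `N` removed. -/
def cutResidual (s t : E → α) (N : Finset E) (χ : E → α → ℝ) (ψ : α → ℝ) (v : α) : ℝ :=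
  ψ v - ∑ e ∈ N, χ e v * ((χ e (t e) - χ e (s e)) * (ψ (t e) - ψ (s e)))

theorem IsCutFamily.cutResidual_eq_of_mem (h : IsCutFamily s t N χ) (ψ : α → ℝ) {e : E}
    (he : e ∈ N) : cutResidual s t N χ ψ (s e) = cutResidual s t N χ ψ (t e) := by
  have h1 : ∑ e' ∈ N, χ e' (t e) * ((χ e' (t e') - χ e' (s e')) * (ψ (t e') - ψ (s e'))) -
      ∑ e' ∈ N, χ e' (s e) * ((χ e' (t e') - χ e' (s e')) * (ψ (t e') - ψ (s e'))) =
      (χ e (t e) - χ e (s e)) * ((χ e (t e) - χ e (s e)) * (ψ (t e) - ψ (s e))) := by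
    rw [← Finset.sum_sub_distrib, Finset.sum_eq_single e]
    · ring
    · intro e' he' hne
      rw [h.const e' he' e hne.symm]; ring
    · exact fun h => absurd he h
  have h2 := h.sq_diff he
  rw [← mul_assoc, ← sq, h2, one_mul] at h1
  simp only [cutResidual]; linarith

theorem IsCutFamily.cutResidual_sub_of_notMem (h : IsCutFamily s t N χ) (ψ : α → ℝ) {e : E}
    (he : e ∉ N) :
    cutResidual s t N χ ψ (t e) - cutResidual s t N χ ψ (s e) = ψ (t e) - ψ (s e) := by
  have h1 : ∑ e' ∈ N, χ e' (t e) * ((χ e' (t e') - χ e' (s e')) * (ψ (t e') - ψ (s e'))) =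
      ∑ e' ∈ N, χ e' (s e) * ((χ e' (t e') - χ e' (s e')) * (ψ (t e') - ψ (s e'))) :=
    Finset.sum_congr rfl fun e' he' => by rw [h.const e' he' e (fun h => he (h ▸ he'))]
  simp only [cutResidual, h1]; ring

/-- In a cut family, the coboundary of a vertex function that is constant along all other edges
recovers the function. -/
theorem IsCutFamily.sum_eq (h : IsCutFamily s t N χ) (hconn : EndsConnected s t) {ψ : α → ℝ}
    (hψ : ∀ e, e ∉ N → ψ (s e) = ψ (t e)) {v w : α} (hv : IsEnd s t v) (hw : IsEnd s t w) :
    ∑ e ∈ N, (χ e w - χ e v) * ((χ e (t e) - χ e (s e)) * (ψ (t e) - ψ (s e))) = ψ w - ψ v := by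
  have hconst : ∀ e, cutResidual s t N χ ψ (s e) = cutResidual s t N χ ψ (t e) := by
    intro e
    by_cases he : e ∈ N
    · exact h.cutResidual_eq_of_mem ψ he
    · have := h.cutResidual_sub_of_notMem ψ he
      rw [hψ e he] at this
      linarith
  have h1 := hconn.eq hconst hv hw
  simp only [cutResidual] at h1
  simp only [sub_mul _ _ ((_ : ℝ) * _), Finset.sum_sub_distrib]
  linarith

variable [Fintype E] {l : E → ℝ}

/-- The distance between two vertices in a tree whose edges of positive length are those in `N`. -/
def cutDist (N : Finset E) (χ : E → α → ℝ) (l : E → ℝ) (v w : α) : ℝ :=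
  ∑ e ∈ N, l e * (χ e w - χ e v) ^ 2

/-- The test function `cos (π d(x) / D)`, where `d(x)` is the position of the projection of `x` to
the path from `v` to `w`, and `D` is the length of that path. -/
theorem Poincare.le_pi_div_cutDist (hl : ∀ e, 0 ≤ l e) (hl1 : ∑ e, l e = 1)
    (hconn : EndsConnected s t) (h : IsCutFamily s t N χ) (hN : ∀ e, e ∈ N ↔ 0 < l e)
    {v w : α} (hv : IsEnd s t v) (hw : IsEnd s t w) (hD : 0 < cutDist N χ l v w) {k : ℝ}
    (hk : Poincare s t l k) : k ≤ Real.pi / cutDist N χ l v w := by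
  classical
  set D := cutDist N χ l v w with hDdef
  set κ := Real.pi / D with hκ
  have hκpos : 0 < κ := by positivity
  have hκD : κ * D = Real.pi := by rw [hκ]; field_simp
  set τ : α → ℝ := fun x => ∑ e ∈ N, l e * ((χ e w - χ e v) * (χ e x - χ e v)) with hτ
  set ε : E → ℝ := fun e =>
    if e ∈ N then (χ e w - χ e v) * (χ e (t e) - χ e (s e)) else 0 with hε
  have hl0 : ∀ e, e ∉ N → l e = 0 := fun e he =>
    le_antisymm (not_lt.1 fun h => he ((hN e).2 h)) (hl e)
  have hτv : τ v = 0 := by simp [hτ]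
  have hτw : τ w = D := by
    simp only [hτ, hDdef, cutDist, sq]
  have hτt : ∀ e, τ (t e) = τ (s e) + ε e * l e := by
    intro e
    by_cases he : e ∈ N
    · have h1 : τ (t e) - τ (s e) = l e * ((χ e w - χ e v) * (χ e (t e) - χ e (s e))) := by
        simp only [hτ]
        rw [← Finset.sum_sub_distrib, Finset.sum_eq_single e]
        · ring
        · intro e' he' hne
          rw [h.const e' he' e hne.symm]; ring
        · exact fun h => absurd he h
      simp only [hε, if_pos he]; linarith
    · simp only [hε, if_neg he, zero_mul, add_zero, hτ]
      refine Finset.sum_congr rfl fun e' he' => ?_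
      rw [h.const e' he' e (fun h => he (h ▸ he'))]
  have hε1 : ∀ e, ε e ^ 2 ≤ 1 := by
    intro e
    by_cases he : e ∈ N
    · simp only [hε, if_pos he, mul_pow, h.sq_diff he, mul_one]
      rcases h.zero_or_one e he v with h1 | h1 <;> rcases h.zero_or_one e he w with h2 | h2 <;>
        simp [h1, h2]
    · simp [hε, if_neg he]
  -- change of variables from the path between `v` and `w` to the interval `[0, D]`
  have hflow : ∀ F Φ : ℝ → ℝ, (∀ y, HasDerivAt Φ (F y) y) → Continuous F →
      ∑ e, ε e ^ 2 * ∫ x in (0 : ℝ)..l e, F (τ (s e) + ε e * x) = Φ D - Φ 0 := by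
    intro F Φ hΦ hF
    have h1 : ∀ e, ε e ^ 2 * ∫ x in (0 : ℝ)..l e, F (τ (s e) + ε e * x) =
        ε e * (Φ (τ (t e)) - Φ (τ (s e))) := by
      intro e
      have h2 := intervalIntegral.integral_eq_sub_of_hasDerivAt (a := 0) (b := l e)
        (f := fun x => Φ (τ (s e) + ε e * x)) (f' := fun x => F (τ (s e) + ε e * x) * ε e)
        (fun x _ => by
          have := (hΦ (τ (s e) + ε e * x)).comp x
            (((hasDerivAt_id x).const_mul (ε e)).const_add (τ (s e)))
          simpa [Function.comp_def] using this)
        (Continuous.intervalIntegrable (by fun_prop) _ _)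
      rw [intervalIntegral.integral_mul_const, ← hτt, mul_zero, add_zero] at h2
      rw [← h2]; ring
    simp only [h1]
    have h3 := h.sum_eq hconn (ψ := fun x => Φ (τ x))
      (fun e he => by simp only [hτt e, hl0 e he, mul_zero, add_zero]) hv hw
    rw [hτv, hτw] at h3
    rw [← h3, ← Finset.sum_subset (Finset.subset_univ N)
      (fun e _ he => by simp [hε, if_neg he])]
    refine Finset.sum_congr rfl fun e he => ?_
    simp only [hε, if_pos he]; ring
  set f : E → ℝ → ℝ := fun e x => Real.cos (κ * (τ (s e) + ε e * x)) with hf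
  set f' : E → ℝ → ℝ := fun e x => -(κ * ε e * Real.sin (κ * (τ (s e) + ε e * x))) with hf'
  have htest : IsTest s t l (fun x => Real.cos (κ * τ x)) f f' := fun e => by
    refine ⟨fun x => ?_, by fun_prop, by simp [hf], by simp only [hf, hτt]⟩
    have := (hasDerivAt_cos_mul κ (τ (s e) + ε e * x)).comp x
      (((hasDerivAt_id x).const_mul (ε e)).const_add (τ (s e)))
    refine (show HasDerivAt (f e) _ x from this).congr_deriv ?_
    simp only [hf']; ring
  obtain ⟨m, hm⟩ := exists_cov_self_eq hl1 htest.continuous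
  have hsin2 : Real.sin (2 * κ * D) = 0 := by
    rw [mul_assoc, hκD, Real.sin_two_pi]
  have hsin1 : Real.sin (κ * D) = 0 := by rw [hκD, Real.sin_pi]
  have henergy : ∑ e, ∫ x in (0 : ℝ)..l e, f' e x ^ 2 = κ ^ 2 * (D / 2) := by
    have h1 := hflow (fun y => Real.sin (κ * y) ^ 2)
      (fun y => y / 2 - Real.sin (2 * κ * y) / (4 * κ)) (fun y => by
        have := ((hasDerivAt_id y).div_const 2).sub
          ((hasDerivAt_sin_mul (2 * κ) y).div_const (4 * κ))
        refine this.congr_deriv ?_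
        rw [mul_assoc 2 κ y, Real.cos_two_mul, Real.cos_sq']
        field_simp; ring) (by fun_prop)
    simp only [hsin2, mul_zero, Real.sin_zero, zero_div, sub_zero] at h1
    rw [← h1, Finset.mul_sum]
    refine Finset.sum_congr rfl fun e _ => ?_
    rw [← intervalIntegral.integral_const_mul, ← intervalIntegral.integral_const_mul]
    congr 1
    funext x
    simp only [hf']; ring
  have hvar : D / 2 ≤ cov l f f := by
    have h1 := hflow (fun y => (Real.cos (κ * y) - m) ^ 2)
      (fun y => y / 2 + Real.sin (2 * κ * y) / (4 * κ) - 2 * m * (Real.sin (κ * y) / κ) + m ^ 2 * y)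
      (fun y => by
        have := ((((hasDerivAt_id y).div_const 2).add
          ((hasDerivAt_sin_mul (2 * κ) y).div_const (4 * κ))).sub
          (((hasDerivAt_sin_mul κ y).div_const κ).const_mul (2 * m))).add
          ((hasDerivAt_id y).const_mul (m ^ 2))
        refine this.congr_deriv ?_
        rw [mul_assoc 2 κ y, Real.cos_two_mul]
        field_simp; ring) (by fun_prop)
    simp only [hsin2, hsin1, mul_zero, Real.sin_zero, zero_div, sub_zero, add_zero] at h1
    have h2 : D / 2 ≤ D / 2 + m ^ 2 * D := by nlinarith [mul_nonneg (sq_nonneg m) hD.le]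
    rw [hm]
    refine h2.trans (h1.symm.le.trans (Finset.sum_le_sum fun e _ => ?_))
    have h3 : 0 ≤ ∫ x in (0 : ℝ)..l e, (Real.cos (κ * (τ (s e) + ε e * x)) - m) ^ 2 :=
      intervalIntegral.integral_nonneg (hl e) fun x _ => sq_nonneg _
    exact mul_le_of_le_one_left h3 (hε1 e)
  have h1 := hk _ _ _ htest
  rw [henergy] at h1
  have h2 : k ^ 2 * (D / 2) ≤ κ ^ 2 * (D / 2) :=
    (mul_le_mul_of_nonneg_left hvar (sq_nonneg k)).trans h1
  exact le_of_sq_le_sq (le_of_mul_le_mul_right h2 (by positivity)) hκpos.le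

end Cuts

/-! ### Leaves of a tree and their distances -/

section Cuts

variable {α E : Type*} {s t : E → α} {N : Finset E} {χ : E → α → ℝ}

/-- The end of the edge `e` on the side where `χ e = 1`. -/
noncomputable def farEnd (s t : E → α) (χ : E → α → ℝ) (e : E) : α :=
  open Classical in if χ e (t e) = 1 then t e else s e

theorem isEnd_farEnd (s t : E → α) (χ : E → α → ℝ) (e : E) : IsEnd s t (farEnd s t χ e) := by
  unfold farEnd
  split_ifs
  exacts [isEnd_finish s t e, isEnd_start s t e]

theorem IsCutFamily.ends_cases (h : IsCutFamily s t N χ) {e : E} (he : e ∈ N) :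
    (χ e (s e) = 0 ∧ χ e (t e) = 1 ∧ farEnd s t χ e = t e) ∨
      (χ e (s e) = 1 ∧ χ e (t e) = 0 ∧ farEnd s t χ e = s e) := by
  have hc := h.cross e he
  rcases h.zero_or_one e he (s e) with h1 | h1 <;> rcases h.zero_or_one e he (t e) with h2 | h2
  · exact absurd (h1.trans h2.symm) hc
  · exact Or.inl ⟨h1, h2, by simp [farEnd, h2]⟩
  · exact Or.inr ⟨h1, h2, by simp [farEnd, h2]⟩
  · exact absurd (h1.trans h2.symm) hc

theorem IsCutFamily.farEnd_eq_one (h : IsCutFamily s t N χ) {e : E} (he : e ∈ N) :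
    χ e (farEnd s t χ e) = 1 := by
  rcases h.ends_cases he with ⟨_, h2, h3⟩ | ⟨h1, _, h3⟩ <;> rw [h3] <;> assumption

theorem IsCutFamily.ends_eq_farEnd (h : IsCutFamily s t N χ) {e e' : E} (he : e ∈ N)
    (hne : e' ≠ e) :
    χ e (s e') = χ e (farEnd s t χ e') ∧ χ e (t e') = χ e (farEnd s t χ e') := by
  have := h.const e he e' hne
  unfold farEnd
  split_ifs
  exacts [⟨this, rfl⟩, ⟨rfl, this.symm⟩]

/-- If an edge `e` lies on the far side of another edge `e'`, then so does its own far side. -/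
theorem IsCutFamily.le_of_farEnd (h : IsCutFamily s t N χ) (hconn : EndsConnected s t) {p : α}
    (hp : IsEnd s t p) (hχp : ∀ e ∈ N, χ e p = 0) {e e' : E} (he : e ∈ N) (he' : e' ∈ N)
    (hfar : χ e' (farEnd s t χ e) = 1) {v : α} (hv : IsEnd s t v) (hχv : χ e v = 1) :
    χ e' v = 1 := by
  by_cases hee : e = e'
  · rwa [← hee]
  -- `χ e (1 - χ e')` changes at most along `e'`, hence is a multiple of `χ e'`; it vanishes at the
  -- far end of `e`
  set c := χ e (farEnd s t χ e') with hc
  obtain ⟨hs', ht'⟩ := h.ends_eq_farEnd he (Ne.symm hee)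
  obtain ⟨hs, ht⟩ := h.ends_eq_farEnd he' hee
  have hconst : ∀ f, χ e (s f) * (1 - χ e' (s f)) + c * χ e' (s f) =
      χ e (t f) * (1 - χ e' (t f)) + c * χ e' (t f) := by
    intro f
    by_cases hf' : f = e'
    · rw [hf', hs', ht', ← hc]; ring
    by_cases hf : f = e
    · rw [hf, hs, ht, hfar]; ring
    · rw [h.const e he f hf, h.const e' he' f hf']
  have h1 := hconn.eq (ψ := fun v => χ e v * (1 - χ e' v) + c * χ e' v) hconst hp hv
  have h2 := hconn.eq (ψ := fun v => χ e v * (1 - χ e' v) + c * χ e' v) hconst hp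
    (isEnd_farEnd s t χ e)
  simp only [hχp e he, hχp e' he', hfar, hχv] at h1 h2
  have hc0 : c = 0 := by linarith
  rw [hc0] at h1
  linarith

/-- The edges that are minimal for the order given by a root `p` of the tree, that is, the edges
next to the leaves. -/
theorem IsCutFamily.exists_minimal_edges (h : IsCutFamily s t N χ) (hconn : EndsConnected s t)
    {p : α} (hp : IsEnd s t p) (hχp : ∀ e ∈ N, χ e p = 0) :
    ∃ M ⊆ N, (∀ e ∈ M, ∀ e' ∈ M, e' ≠ e → χ e (farEnd s t χ e') = 0) ∧
      ∀ e ∈ N, ∃ e' ∈ M, χ e (farEnd s t χ e') = 1 := by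
  classical
  refine ⟨N.filter fun e => ∀ e' ∈ N, χ e (farEnd s t χ e') = 1 → e' = e,
    Finset.filter_subset _ _, fun e he e' he' hne => ?_, fun e he => ?_⟩
  · rw [Finset.mem_filter] at he he'
    exact (h.zero_or_one e he.1 _).resolve_right fun h1 => hne (he.2 e' he'.1 h1)
  · obtain ⟨e', he', hmin⟩ := Finset.exists_min_image
      (N.filter fun e' => χ e (farEnd s t χ e') = 1)
      (fun e' => (N.filter fun f => χ e' (farEnd s t χ f) = 1).card)
      ⟨e, Finset.mem_filter.2 ⟨he, h.farEnd_eq_one he⟩⟩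
    rw [Finset.mem_filter] at he'
    refine ⟨e', Finset.mem_filter.2 ⟨he'.1, fun f hf hfe' => ?_⟩, he'.2⟩
    by_contra hne
    have hfe : χ e (farEnd s t χ f) = 1 :=
      h.le_of_farEnd hconn hp hχp he'.1 he he'.2 (isEnd_farEnd s t χ f) hfe'
    refine absurd (hmin f (Finset.mem_filter.2 ⟨hf, hfe⟩)) (not_le.2 (Finset.card_lt_card ?_))
    have hsub : ∀ v, IsEnd s t v → χ f v = 1 → χ e' v = 1 := fun v hv hχv =>
      h.le_of_farEnd hconn hp hχp hf he'.1 hfe' hv hχv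
    rw [Finset.ssubset_iff_of_subset]
    · refine ⟨e', Finset.mem_filter.2 ⟨he'.1, h.farEnd_eq_one he'.1⟩, fun hmem => ?_⟩
      -- otherwise `f` and `e'` would cut off the same vertices
      have hfe'' : χ f (farEnd s t χ e') = 1 := (Finset.mem_filter.1 hmem).2
      obtain ⟨h1, h2⟩ := h.ends_eq_farEnd hf (Ne.symm hne)
      rw [hfe''] at h1 h2
      have h4 := hsub _ (isEnd_start s t e') h1
      have h5 := hsub _ (isEnd_finish s t e') h2
      exact h.cross e' he'.1 (h4.trans h5.symm)
    · intro g hg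
      rw [Finset.mem_filter] at hg ⊢
      exact ⟨hg.1, hsub _ (isEnd_farEnd s t χ g) hg.2⟩

variable {l : E → ℝ}

/-- Among `n` vertices such that each edge separates two of them, there are two at distance at
least `2 / n`: averaging over all pairs, each edge separates at least `n - 1` of them. -/
theorem IsCutFamily.exists_cutDist_ge (h : IsCutFamily s t N χ) (hl : ∀ e, 0 ≤ l e)
    (hl1 : ∑ e ∈ N, l e = 1) {ι : Type*} [Fintype ι] (T : ι → α)
    (hsep : ∀ e ∈ N, ∃ i j, χ e (T i) = 0 ∧ χ e (T j) = 1) :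
    ∃ i j, 2 / (Fintype.card ι : ℝ) ≤ cutDist N χ l (T i) (T j) := by
  classical
  set n := Fintype.card ι with hn
  have hedge : ∀ e ∈ N, 2 * ((n : ℝ) - 1) ≤ ∑ i, ∑ j, (χ e (T j) - χ e (T i)) ^ 2 := by
    intro e he
    obtain ⟨i₀, j₀, hi₀, hj₀⟩ := hsep e he
    have hsq : ∀ i, χ e (T i) ^ 2 = χ e (T i) := fun i => by
      rcases h.zero_or_one e he (T i) with h1 | h1 <;> simp [h1]
    have hnn : ∀ i, 0 ≤ χ e (T i) := fun i => by
      rcases h.zero_or_one e he (T i) with h1 | h1 <;> simp [h1]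
    have hle : ∀ i, χ e (T i) ≤ 1 := fun i => by
      rcases h.zero_or_one e he (T i) with h1 | h1 <;> simp [h1]
    set a := ∑ i, χ e (T i) with ha
    have ha1 : 1 ≤ a := by
      rw [← hj₀]
      exact Finset.single_le_sum (f := fun i => χ e (T i)) (fun i _ => hnn i) (Finset.mem_univ j₀)
    have han : a ≤ n - 1 := by
      have h1 : ∑ i, (1 - χ e (T i)) = n - a := by
        rw [Finset.sum_sub_distrib]; simp [hn, ha]
      have h2 := Finset.single_le_sum (f := fun i => 1 - χ e (T i))
        (fun i _ => sub_nonneg.2 (hle i)) (Finset.mem_univ i₀)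
      simp only [h1, hi₀] at h2
      linarith
    have h3 : ∑ i, ∑ j, (χ e (T j) - χ e (T i)) ^ 2 = 2 * (a * (n - a)) := by
      have h4 : ∀ i j, (χ e (T j) - χ e (T i)) ^ 2 =
          χ e (T j) + χ e (T i) - 2 * (χ e (T i) * χ e (T j)) := fun i j => by
        rw [sub_sq, hsq, hsq]; ring
      simp only [h4, Finset.sum_sub_distrib, Finset.sum_add_distrib, ← Finset.mul_sum, ← ha,
        ← Finset.sum_mul, Finset.sum_const, Finset.card_univ, ← hn, nsmul_eq_mul]
      ring
    rw [h3]
    nlinarith [mul_nonneg (sub_nonneg.2 ha1) (sub_nonneg.2 han)]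
  have hsum : 2 * ((n : ℝ) - 1) ≤ ∑ i, ∑ j, cutDist N χ l (T i) (T j) := by
    calc 2 * ((n : ℝ) - 1) = ∑ e ∈ N, l e * (2 * ((n : ℝ) - 1)) := by
          rw [← Finset.sum_mul, hl1, one_mul]
      _ ≤ ∑ e ∈ N, l e * ∑ i, ∑ j, (χ e (T j) - χ e (T i)) ^ 2 :=
          Finset.sum_le_sum fun e he => mul_le_mul_of_nonneg_left (hedge e he) (hl e)
      _ = ∑ i, ∑ j, cutDist N χ l (T i) (T j) := by
          simp only [cutDist, Finset.mul_sum]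
          rw [Finset.sum_comm]
          exact Finset.sum_congr rfl fun i _ => Finset.sum_comm
  have hNne : N.Nonempty := by
    by_contra hN
    rw [Finset.not_nonempty_iff_eq_empty.1 hN, Finset.sum_empty] at hl1
    exact zero_ne_one hl1
  obtain ⟨e, he⟩ := hNne
  obtain ⟨i₀, j₀, hi₀, hj₀⟩ := hsep e he
  have hij : i₀ ≠ j₀ := fun hij => by rw [hij, hj₀] at hi₀; exact one_ne_zero hi₀
  have hoff : (Finset.univ : Finset ι).offDiag.Nonempty :=
    ⟨(i₀, j₀), Finset.mem_offDiag.2 ⟨Finset.mem_univ _, Finset.mem_univ _, hij⟩⟩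
  have hn1 : 1 ≤ n := Fintype.card_pos_iff.2 ⟨i₀⟩
  have hoffsum : ∑ q ∈ (Finset.univ : Finset ι).offDiag, cutDist N χ l (T q.1) (T q.2) =
      ∑ i, ∑ j, cutDist N χ l (T i) (T j) := by
    rw [← Finset.sum_product', Finset.univ_product_univ]
    refine Finset.sum_subset (Finset.subset_univ _) fun q _ hq => ?_
    have : q.1 = q.2 := by simpa [Finset.mem_offDiag] using hq
    simp [cutDist, this]
  have hcard : ((Finset.univ : Finset ι).offDiag.card : ℝ) = n * (n - 1) := by
    rw [Finset.offDiag_card, Finset.card_univ, ← hn, Nat.cast_sub (Nat.le_mul_self n)]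
    push_cast; ring
  obtain ⟨q, -, hq⟩ := Finset.exists_le_of_sum_le hoff
    (f := fun _ => 2 / (n : ℝ)) (g := fun q : ι × ι => cutDist N χ l (T q.1) (T q.2)) (by
      rw [hoffsum, Finset.sum_const, nsmul_eq_mul, hcard]
      have : (n : ℝ) ≠ 0 := by positivity
      calc (n : ℝ) * (n - 1) * (2 / n) = 2 * (n - 1) := by field_simp
        _ ≤ _ := hsum)
  exact ⟨q.1, q.2, hq⟩

end Cuts

/-! ### The spectral gap of a stower -/

section Stower

variable {α E : Type*} {s t : E → α} {M : Finset E} {χ : E → α → ℝ}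

/-- Replace each cut indicator by its complement, if necessary, so that it vanishes at `p`. -/
theorem IsCutFamily.exists_normalized {N : Finset E} (h : IsCutFamily s t N χ) (p : α) :
    ∃ χ', IsCutFamily s t N χ' ∧ ∀ e ∈ N, χ' e p = 0 := by
  classical
  refine ⟨fun e v => if χ e p = 0 then χ e v else 1 - χ e v, ⟨fun e he v => ?_, fun e he => ?_,
    fun e he e' hne => ?_⟩, fun e he => ?_⟩
  · rcases h.zero_or_one e he v with h1 | h1 <;> by_cases hp : χ e p = 0 <;> simp [h1, hp]
  · have := h.cross e he
    by_cases hp : χ e p = 0 <;> simp [hp, this]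
  · rw [h.const e he e' hne]
  · rcases h.zero_or_one e he p with h1 | h1 <;> simp [h1]

variable [Fintype E]

/-- If all edges except the bridges in `M` and one edge `e₀` on a cycle are contracted, the result
is a stower: a loop `e₀` with pendant edges attached to its vertex. If the pendant edges have
length `a` and the loop has length `2 a`, then all positive eigenvalues `k²` have `k ≥ π / (2 a)`:
for smaller `k`, the sum of the outgoing derivatives at the central vertex is a positive multiple
of the value there. -/
theorem IsEigenfunction.pi_div_two_le_of_stower (h : IsCutFamily s t M χ)
    (hconn : EndsConnected s t) {e₀ : E} (he₀ : e₀ ∉ M)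
    (hbr : ∀ ψ : α → ℝ, (∀ e, e ≠ e₀ → ψ (s e) = ψ (t e)) → ψ (s e₀) = ψ (t e₀))
    (hχ0 : ∀ e ∈ M, χ e (s e₀) = 0)
    (hanti : ∀ e ∈ M, ∀ e' ∈ M, e' ≠ e → χ e (farEnd s t χ e') = 0) {a : ℝ} (ha : 0 < a)
    {m : E → ℝ} (hmM : ∀ e ∈ M, m e = a) (hm0 : m e₀ = 2 * a)
    (hmz : ∀ e, e ≠ e₀ → e ∉ M → m e = 0) (hm1 : ∑ e, m e = 1) {k : ℝ} (hk : 0 < k) {φ : α → ℝ}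
    {b : E → ℝ} (heig : IsEigenfunction s t m k φ b) : Real.pi / 2 ≤ k * a := by
  by_contra! hlt
  have hka : 0 < k * a := by positivity
  set S := Real.sin (k * a) with hS
  set C := Real.cos (k * a) with hC
  have hSpos : 0 < S := Real.sin_pos_of_pos_of_lt_pi hka (by linarith)
  have hCpos : 0 < C := Real.cos_pos_of_mem_Ioo ⟨by linarith, hlt⟩
  have hSC : S ^ 2 + C ^ 2 = 1 := Real.sin_sq_add_cos_sq _
  have hzero : ∀ e, m e = 0 → φ (s e) = φ (t e) := fun e he => by
    have := heig.match_end e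
    rw [he] at this
    simpa using this
  have hχ0' : ∀ e ∈ M, χ e (t e₀) = 0 := fun e he => by
    rw [← h.const e he e₀ (fun h => he₀ (h ▸ he)), hχ0 e he]
  -- the pendant edges do not lie on the far side of each other
  have hχM : ∀ e ∈ M, ∀ e' ∈ M, e' ≠ e → χ e (s e') = 0 ∧ χ e (t e') = 0 := by
    intro e he e' he' hne
    have := h.ends_eq_farEnd he hne
    rwa [hanti e he e' he' hne] at this
  have hloop : φ (s e₀) = φ (t e₀) := by
    have h1 := hbr (cutResidual s t M χ φ) fun e he => by
      by_cases heM : e ∈ M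
      · exact h.cutResidual_eq_of_mem φ heM
      · have := h.cutResidual_sub_of_notMem φ heM
        rw [hzero e (hmz e he heM)] at this
        linarith
    have h2 := h.cutResidual_sub_of_notMem φ he₀
    linarith
  set v := φ (s e₀) with hv
  have hnear : ∀ w, IsEnd s t w → (∀ e ∈ M, χ e w = 0) → φ w = v := by
    intro w hw hχw
    have h1 := h.sum_eq hconn (ψ := φ) (fun e he => by
      by_cases hee : e = e₀
      · rw [hee]; exact hloop
      · exact hzero e (hmz e hee he)) (isEnd_start s t e₀) hw
    rw [Finset.sum_eq_zero fun e he => by rw [hχw e he, hχ0 e he]; ring] at h1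
    linarith
  -- the Neumann condition at the leaves
  have hleaf : ∀ e ∈ M,
      waveDeriv k (φ (s e)) (b e) a * χ e (t e) - k * b e * χ e (s e) = 0 := by
    intro e he
    have h1 := heig.kirchhoff (χ e) fun e' he' => h.const e he e' fun hee => by
      rw [hee, hmM e he] at he'; exact ha.ne' he'
    rw [Finset.sum_eq_single e] at h1
    · rwa [hmM e he] at h1
    · intro e' _ hne
      by_cases hM : e' ∈ M
      · rw [(hχM e he e' hM hne).1, (hχM e he e' hM hne).2]; ring
      · by_cases h0 : e' = e₀
        · rw [h0, hχ0 e he, hχ0' e he]; ring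
        · rw [hmz e' h0 hM, waveDeriv_zero, h.const e he e' hne]; ring
    · exact fun h => absurd (Finset.mem_univ e) h
  have hedgeM : ∀ e ∈ M, waveDeriv k (φ (s e)) (b e) a - k * b e = -(k * v * (S / C)) ∧
      (v = 0 → φ (s e) = 0 ∧ b e = 0) := by
    intro e he
    have h1 := hleaf e he
    have h2 := heig.match_end e
    rw [hmM e he] at h2
    simp only [waveDeriv, wave, ← hS, ← hC] at h1 h2 ⊢
    rcases h.ends_cases he with ⟨h3, h4, h5⟩ | ⟨h3, h4, h5⟩
    · have h6 : φ (s e) = v := hnear _ (isEnd_start s t e) fun e' he' => by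
        by_cases hee : e' = e
        · rw [hee, h3]
        · exact (hχM e' he' e he (Ne.symm hee)).1
      rw [h3, h4, h6] at h1
      have h7 : b e * C = v * S := by
        have : k * (b e * C - v * S) = 0 := by linarith
        have := (mul_eq_zero.1 this).resolve_left hk.ne'
        linarith
      have h8 : b e = v * (S / C) := by rw [mul_div_assoc', eq_div_iff hCpos.ne', h7]
      rw [h6]
      refine ⟨?_, fun hv0 => ⟨hv0, by rw [h8, hv0, zero_mul]⟩⟩
      rw [h7, h8]; ring
    · have h6 : φ (t e) = v := hnear _ (isEnd_finish s t e) fun e' he' => by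
        by_cases hee : e' = e
        · rw [hee, h4]
        · exact (hχM e' he' e he (Ne.symm hee)).2
      have h7 : b e = 0 := by
        rw [h3, h4] at h1
        have : k * b e = 0 := by linarith
        exact (mul_eq_zero.1 this).resolve_left hk.ne'
      rw [h6, h7, zero_mul, add_zero] at h2
      have h8 : φ (s e) = v / C := by rw [eq_div_iff hCpos.ne', h2]
      refine ⟨by rw [h7, h8]; ring, fun hv0 => ⟨by rw [h8, hv0, zero_div], h7⟩⟩
  have hedge0 : waveDeriv k (φ (s e₀)) (b e₀) (2 * a) - k * b e₀ = -(k * v * (S / C)) * 2 ∧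
      (v = 0 → b e₀ = 0) := by
    have h2 := heig.match_end e₀
    rw [hm0, ← hloop] at h2
    have hd : k * (2 * a) = 2 * (k * a) := by ring
    simp only [waveDeriv, wave, hd, Real.cos_two_mul, Real.sin_two_mul, ← hS, ← hC, ← hv] at h2 ⊢
    have h7 : b e₀ * C = v * S := by
      have h3 : (2 * S) * (b e₀ * C - v * S) = 0 := by
        have : C ^ 2 = 1 - S ^ 2 := by linarith
        rw [this] at h2
        linarith
      have := (mul_eq_zero.1 h3).resolve_left (by positivity)
      linarith
    have h8 : b e₀ = v * (S / C) := by rw [mul_div_assoc', eq_div_iff hCpos.ne', h7]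
    refine ⟨?_, fun hv0 => by rw [h8, hv0, zero_mul]⟩
    rw [h8]
    have : C ^ 2 = 1 - S ^ 2 := by linarith
    field_simp
    rw [this]; ring
  have hall : ∀ e, waveDeriv k (φ (s e)) (b e) (m e) * 1 - k * b e * 1 =
      -(k * v * (S / C)) / a * m e := by
    intro e
    rw [mul_one, mul_one]
    by_cases hM : e ∈ M
    · rw [hmM e hM, (hedgeM e hM).1]; field_simp
    by_cases h0 : e = e₀
    · rw [h0, hm0, hedge0.1]; field_simp
    · rw [hmz e h0 hM, waveDeriv_zero]; ring
  have hsum := heig.kirchhoff (fun _ => 1) fun _ _ => rfl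
  rw [Finset.sum_congr rfl fun e _ => hall e, ← Finset.mul_sum, hm1, mul_one] at hsum
  have hv0 : v = 0 := by
    by_contra hne
    refine absurd hsum (div_ne_zero (neg_ne_zero.2 ?_) ha.ne')
    positivity
  obtain ⟨e, hme, hne⟩ := heig.nontrivial
  by_cases hM : e ∈ M
  · have := (hedgeM e hM).2 hv0
    exact hne.elim (fun h => h this.1) fun h => h this.2
  by_cases h0 : e = e₀
  · subst h0
    exact hne.elim (fun h => h hv0) fun h => h (hedge0.2 hv0)
  · exact hme.ne' (hmz e h0 hM)

/-- If all edges of positive length are bridges, while some edge is not, then there are other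
lengths for which the spectral gap is larger. -/
theorem exists_lengths_improving {l : E → ℝ} (hl : ∀ e, 0 ≤ l e) (hl1 : ∑ e, l e = 1)
    (hconn : EndsConnected s t) {N : Finset E} (h : IsCutFamily s t N χ)
    (hN : ∀ e, e ∈ N ↔ 0 < l e) {e₀ : E}
    (hbr : ∀ ψ : α → ℝ, (∀ e, e ≠ e₀ → ψ (s e) = ψ (t e)) → ψ (s e₀) = ψ (t e₀)) :
    ∃ m : E → ℝ, (∀ e, 0 ≤ m e) ∧ ∑ e, m e = 1 ∧ ∃ c c' : ℝ, c < c' ∧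
      (∀ k, Poincare s t l k → k ≤ c) ∧
      ∀ k φ b, 0 < k → IsEigenfunction s t m k φ b → c' ≤ k := by
  classical
  have he₀N : e₀ ∉ N := fun he => h.cross e₀ he (hbr (χ e₀) fun e hne => h.const e₀ he e hne)
  obtain ⟨χ, h, hχp⟩ := h.exists_normalized (s e₀)
  have hp := isEnd_start s t e₀
  obtain ⟨M, hMN, hanti, hbelow⟩ := h.exists_minimal_edges hconn hp hχp
  have he₀M : e₀ ∉ M := fun he => he₀N (hMN he)
  have hM : IsCutFamily s t M χ := ⟨fun e he => h.zero_or_one e (hMN he),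
    fun e he => h.cross e (hMN he), fun e he => h.const e (hMN he)⟩
  set r : ℝ := (M.card : ℝ) with hr
  have hr0 : 0 ≤ r := Nat.cast_nonneg _
  have hlN : ∑ e ∈ N, l e = 1 := by
    rw [← hl1]
    refine Finset.sum_subset (Finset.subset_univ N) fun e _ he => ?_
    exact le_antisymm (not_lt.1 fun h => he ((hN e).2 h)) (hl e)
  -- the distances between the root and the leaves
  let T : Option M → α := fun i => i.elim (s e₀) fun e => farEnd s t χ e
  have hT : ∀ i, IsEnd s t (T i) := by
    rintro (_ | e)
    exacts [hp, isEnd_farEnd s t χ e]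
  obtain ⟨i, j, hij⟩ := h.exists_cutDist_ge hl hlN T fun e he => by
    obtain ⟨e', he', h1⟩ := hbelow e he
    exact ⟨none, some ⟨e', he'⟩, hχp e he, h1⟩
  have hcard : ((Fintype.card (Option M) : ℕ) : ℝ) = r + 1 := by simp [hr]
  rw [hcard] at hij
  have hDpos : 0 < cutDist N χ l (T i) (T j) := lt_of_lt_of_le (by positivity) hij
  -- `r` pendant edges of length `a` and a loop of length `2 a` have total length one
  set a : ℝ := 1 / (r + 2) with ha
  have hapos : 0 < a := by positivity
  let m : E → ℝ := fun e => (if e = e₀ then 2 * a else 0) + if e ∈ M then a else 0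
  have hmM : ∀ e ∈ M, m e = a := fun e he => by
    have : e ≠ e₀ := fun h => he₀M (h ▸ he)
    simp [m, he, this]
  have hm0 : m e₀ = 2 * a := by simp [m, he₀M]
  have hmz : ∀ e, e ≠ e₀ → e ∉ M → m e = 0 := fun e h1 h2 => by simp [m, h1, h2]
  have hm1 : ∑ e, m e = 1 := by
    simp only [m, Finset.sum_add_distrib, Finset.sum_ite_eq', Finset.mem_univ, if_true,
      Finset.sum_ite_mem, Finset.univ_inter, Finset.sum_const, nsmul_eq_mul, ← hr, ha]
    field_simp; ring
  refine ⟨m, fun e => ?_, hm1, Real.pi * (r + 1) / 2, Real.pi * (r + 2) / 2, ?_, ?_, ?_⟩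
  · simp only [m]; positivity
  · have := Real.pi_pos
    gcongr; norm_num
  · intro k hk
    refine (hk.le_pi_div_cutDist hl hl1 hconn h hN (hT i) (hT j) hDpos).trans ?_
    calc Real.pi / cutDist N χ l (T i) (T j) ≤ Real.pi / (2 / (r + 1)) := by gcongr
      _ = Real.pi * (r + 1) / 2 := by field_simp
  · intro k φ b hk heig
    have h1 := heig.pi_div_two_le_of_stower hM hconn he₀M hbr (fun e he => hχp e (hMN he)) hanti
      hapos hmM hm0 hmz hm1 hk
    rw [ha, mul_one_div, le_div_iff₀ (by positivity)] at h1
    linarith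

end Stower

/-! ### Eigenvalues of the contracted metric graph -/

section Translation

variable {α β : Type*} {G : Graph α β}

/-- The chosen start of an edge. -/
noncomputable abbrev edgeStart (G : Graph α β) (e : E(G)) : α := (ends G e).1

/-- The chosen end of an edge. -/
noncomputable abbrev edgeFinish (G : Graph α β) (e : E(G)) : α := (ends G e).2

/-- A vertex function takes the same value at both ends of an edge if it does so at its chosen start
and end. -/
theorem eq_of_isLink {X : Type*} {ψ : α → X} {e : β} {x y : α} (h : G.IsLink e x y)
    (hψ : ψ (edgeStart G ⟨e, h.edge_mem⟩) = ψ (edgeFinish G ⟨e, h.edge_mem⟩)) : ψ x = ψ y := by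
  rcases h.eq_and_eq_or_eq_and_eq (ends_isLink G ⟨e, h.edge_mem⟩) with ⟨h1, h2⟩ | ⟨h1, h2⟩
  · exact (congrArg ψ h1).trans (hψ.trans (congrArg ψ h2).symm)
  · exact (congrArg ψ h1).trans (hψ.symm.trans (congrArg ψ h2).symm)

/-- A vertex function that is constant along contracted edges descends to the contracted graph. -/
def descend {X : Type*} {l : E(G) → ℝ} (ψ : α → X)
    (hψ : ∀ e, l e = 0 → ψ (edgeStart G e) = ψ (edgeFinish G e)) :
    Quot (contractRel G (zeroEdges G l)) → X :=
  Quot.lift ψ (by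
    rintro x y ⟨e, ⟨he, hl⟩, hlink⟩
    exact eq_of_isLink hlink (hψ _ hl))

theorem mk_edgeStart_eq {l : E(G) → ℝ} {e : E(G)} (he : l e = 0) :
    Quot.mk (contractRel G (zeroEdges G l)) (edgeStart G e) =
      Quot.mk (contractRel G (zeroEdges G l)) (edgeFinish G e) :=
  Quot.sound ⟨e.1, ⟨e.2, he⟩, ends_isLink G e⟩

theorem origEdge_injective {C : Set β} : Function.Injective (origEdge (G := G) (C := C)) := by
  intro e e' h
  exact Subtype.ext (congrArg (Subtype.val : E(G) → β) h)

/-- The closure of the open simplex of lengths is the closed simplex. -/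
theorem mem_closedLengths_iff [Fintype E(G)] {l : E(G) → ℝ} :
    l ∈ closedLengths G ↔ (∀ e, 0 ≤ l e) ∧ ∑ e, l e = 1 := by
  constructor
  · intro hl
    refine ⟨closedLengths_nonneg hl, ?_⟩
    have hc : IsClosed {m : E(G) → ℝ | ∑ e, m e = 1} :=
      isClosed_eq (by fun_prop) continuous_const
    refine closure_minimal (fun m (hm : m ∈ lengths G) => ?_) hc hl
    rw [mem_ofPred_eq, ← finsum_eq_sum_of_fintype]
    exact hm.1
  · rintro ⟨hl, hl1⟩
    have hne : Nonempty E(G) := by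
      by_contra hE
      rw [not_nonempty_iff] at hE
      simp at hl1
    set n : ℝ := (Fintype.card E(G) : ℝ) with hn
    have hnpos : 0 < n := by rw [hn]; exact_mod_cast Fintype.card_pos
    -- approach `l` along the segment from the barycenter of the simplex
    have hlim : Tendsto (fun ε : ℝ => fun e => (1 - ε) * l e + ε * n⁻¹) (𝓝[>] 0)
        (𝓝 (fun e => (1 - 0) * l e + 0 * n⁻¹)) :=
      (Continuous.tendsto (f := fun ε : ℝ => fun e => (1 - ε) * l e + ε * n⁻¹)
        (by fun_prop) 0).mono_left nhdsWithin_le_nhds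
    simp only [sub_zero, one_mul, zero_mul, add_zero] at hlim
    refine mem_closure_of_tendsto hlim ?_
    filter_upwards [Ioo_mem_nhdsGT (zero_lt_one' ℝ)] with ε hε
    refine ⟨?_, fun e => ?_⟩
    · rw [finsum_eq_sum_of_fintype, Finset.sum_add_distrib, ← Finset.mul_sum, hl1,
        Finset.sum_const, Finset.card_univ, nsmul_eq_mul, ← hn]
      field_simp; ring
    · have h1 : 0 ≤ (1 - ε) * l e := mul_nonneg (by linarith [hε.2]) (hl e)
      have h2 : 0 < ε * n⁻¹ := mul_pos hε.1 (inv_pos.2 hnpos)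
      linarith

theorem isCompact_closedLengths [Fintype E(G)] : IsCompact (closedLengths G) := by
  refine IsCompact.of_isClosed_subset (isCompact_univ_pi fun _ : E(G) =>
    isCompact_Icc (a := (0 : ℝ)) (b := 1)) isClosed_closure fun l hl e _ => ?_
  have hl' := mem_closedLengths_iff.1 hl
  exact ⟨hl'.1 e, length_le_one hl'.1 hl'.2 e⟩

theorem finite_contract_edgeSet [Fintype E(G)] (C : Set β) : Finite E(contract G C) :=
  Finite.of_injective _ origEdge_injective

theorem sum_contract [Fintype E(G)] {l : E(G) → ℝ} [Fintype E(contract G (zeroEdges G l))]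
    {X : Type*} [AddCommMonoid X] (F : E(G) → X) (hF : ∀ e, l e = 0 → F e = 0) :
    ∑ e : E(contract G (zeroEdges G l)), F (origEdge e) = ∑ e, F e := by
  classical
  refine (Finset.sum_map Finset.univ ⟨origEdge, origEdge_injective⟩ F).symm.trans ?_
  refine Finset.sum_subset (Finset.subset_univ _) fun e _ he => hF e ?_
  by_contra hle
  refine he (Finset.mem_map.2 ⟨⟨e.1, e.2, fun h => hle h.2⟩, Finset.mem_univ _, rfl⟩)

theorem isSobolevH2_wave (k A B l : ℝ) : IsSobolevH2 l (fun x => (wave k A B x : ℂ))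
    (fun x => (waveDeriv k A B x : ℂ)) (fun x => ((-(k ^ 2 * wave k A B x) : ℝ) : ℂ)) := by
  refine ⟨?_, fun x _ => ?_, fun x _ => ?_⟩
  · have hc : Continuous fun x => ((-(k ^ 2 * wave k A B x) : ℝ) : ℂ) := by fun_prop
    obtain ⟨C, hC⟩ := (isCompact_Icc (a := (0 : ℝ)) (b := l)).exists_bound_of_continuousOn
      hc.continuousOn
    refine MemLp.of_bound hc.aestronglyMeasurable C ?_
    filter_upwards [ae_restrict_mem measurableSet_Icc] with x hx using hC x hx
  · rw [intervalIntegral.integral_ofReal, intervalIntegral.integral_eq_sub_of_hasDerivAt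
      (fun x _ => hasDerivAt_waveDeriv k A B x) (Continuous.intervalIntegrable (by fun_prop) _ _)]
    push_cast; ring
  · rw [intervalIntegral.integral_ofReal, intervalIntegral.integral_eq_sub_of_hasDerivAt
      (fun x _ => hasDerivAt_wave k A B x) (Continuous.intervalIntegrable (by fun_prop) _ _)]
    push_cast; ring

/-- The solutions of class `H²` of the eigenvalue equation on an edge are the trigonometric ones. -/
theorem IsSobolevH2.eq_cos_add_sin {l k : ℝ} (hl : 0 ≤ l) (hk : 0 < k) {f f' f'' : ℝ → ℂ}
    (h : IsSobolevH2 l f f' f'')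
    (heq : ∀ᵐ x ∂(volume.restrict (Icc 0 l)), -f'' x = ((k ^ 2 : ℝ) : ℂ) * f x) {x : ℝ}
    (hx : x ∈ Icc 0 l) :
    f x = Real.cos (k * x) • f 0 + Real.sin (k * x) • (k⁻¹ • f' 0) ∧
      f' x = -(k * Real.sin (k * x)) • f 0 + (k * Real.cos (k * x)) • (k⁻¹ • f' 0) := by
  have hprim : ∀ {u v : ℝ → ℂ}, IntegrableOn v (Icc 0 l) →
      (∀ x ∈ Icc 0 l, u x = u 0 + ∫ t in (0 : ℝ)..x, v t) → ContinuousOn u (Icc 0 l) := by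
    intro u v hv huv
    rw [← uIcc_of_le hl] at hv ⊢
    refine ((continuousOn_const (c := u 0)).add
      (intervalIntegral.continuousOn_primitive_interval hv)).congr fun x hx => ?_
    rw [uIcc_of_le hl] at hx
    exact huv x hx
  have hi'' : IntegrableOn f'' (Icc 0 l) := h.memLp.integrable (by norm_num)
  have hc' := hprim hi'' h.eq_integral'
  have hc := hprim (hc'.integrableOn_compact isCompact_Icc) h.eq_integral
  refine eq_cos_add_sin_of_integral_eq hl hk hc (fun x hx => ?_) h.eq_integral hx
  rw [h.eq_integral' x hx, ← intervalIntegral.integral_smul, sub_eq_add_neg,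
    ← intervalIntegral.integral_neg]
  congr 1
  rw [intervalIntegral.integral_of_le hx.1, intervalIntegral.integral_of_le hx.1]
  refine integral_congr_ae ?_
  filter_upwards [ae_mono (Measure.restrict_mono
    (Ioc_subset_Icc_self.trans (Icc_subset_Icc_right hx.2)) le_rfl) heq] with y hy
  rw [Complex.real_smul, ← hy, neg_neg]

end Translation

section Translation

variable {α β : Type*} {G : Graph α β} [Fintype E(G)] {l : E(G) → ℝ}

/-- The waves on the edges of positive length form an eigenfunction on the contracted graph. -/
theorem IsEigenfunction.isEigenvalue (hl : l ∈ closedLengths G) {k : ℝ} (hk : 0 < k)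
    {φ : α → ℝ} {b : E(G) → ℝ}
    (h : IsEigenfunction (edgeStart G) (edgeFinish G) l k φ b) :
    (metricGraph G l hl).IsEigenvalue (k ^ 2) := by
  classical
  have : Finite E(contract G (zeroEdges G l)) := finite_contract_edgeSet _
  let inst : Fintype E(contract G (zeroEdges G l)) := Fintype.ofFinite _
  let inst' : Fintype E((metricGraph G l hl).graph) := inst
  have hzero : ∀ e, l e = 0 → φ (edgeStart G e) = φ (edgeFinish G e) := fun e he => by
    have := h.match_end e
    rw [he] at this
    simpa using this
  let u : E(G) → ℝ → ℝ := fun e => wave k (φ (edgeStart G e)) (b e)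
  let u' : E(G) → ℝ → ℝ := fun e => waveDeriv k (φ (edgeStart G e)) (b e)
  refine ⟨fun e x => (u (origEdge e) x : ℂ), fun e x => (u' (origEdge e) x : ℂ),
    fun e x => ((-(k ^ 2 * u (origEdge e) x) : ℝ) : ℂ),
    ⟨fun e => isSobolevH2_wave _ _ _ _, ⟨descend (fun v => (φ v : ℂ)) (fun e he => by
      rw [hzero e he]), fun e => ⟨?_, ?_⟩⟩, fun v _ => ?_⟩, fun e => ?_, ?_⟩
  · simp only [u, wave_zero]; rfl
  · exact congrArg _ (h.match_end (origEdge e))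
  · -- test the weak Kirchhoff condition against the indicator of `v`
    have h1 := h.kirchhoff (fun x => if Quot.mk _ x = v then 1 else 0)
      fun e he => by rw [mk_edgeStart_eq he]
    simp only [finsum_eq_if]
    rw [finsum_eq_sum_of_fintype, finsum_eq_sum_of_fintype, ← Finset.sum_add_distrib]
    have h2 := (sum_contract (l := l) (fun e : E(G) =>
      u' e (l e) * (if Quot.mk (contractRel G (zeroEdges G l)) (edgeFinish G e) = v then 1 else 0)
        - k * b e * (if Quot.mk (contractRel G (zeroEdges G l)) (edgeStart G e) = v then 1 else 0))
      (fun e he => by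
        rw [mk_edgeStart_eq he, he]
        simp [u'])).trans h1
    have h3 := congrArg (fun r : ℝ => (r : ℂ)) h2
    simp only [Complex.ofReal_sum, Complex.ofReal_zero] at h3
    refine neg_eq_zero.1 (Eq.trans ?_ h3)
    rw [← Finset.sum_neg_distrib]
    refine Finset.sum_congr rfl fun e _ => ?_
    change -((if Quot.mk _ (edgeStart G (origEdge e)) = v then _ else _) +
      (if Quot.mk _ (edgeFinish G (origEdge e)) = v then _ else _)) = _
    have h4 : u' (origEdge e) 0 = k * b (origEdge e) := waveDeriv_zero _ _ _
    rw [h4]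
    split_ifs <;> simp [metricGraph, sub_eq_add_neg]
  · exact Eventually.of_forall fun x => by push_cast; ring
  · obtain ⟨e, he, hne⟩ := h.nontrivial
    obtain ⟨x, hx, hxne⟩ := exists_wave_ne_zero hk he hne
    exact ⟨⟨e.1, e.2, fun h => he.ne' h.2⟩, x, hx, Complex.ofReal_ne_zero.2 hxne⟩

/-- Conversely, the real or the imaginary part of an eigenfunction on the contracted graph consists
of waves on the edges of positive length. The pointwise Kirchhoff condition gives the weak one by
summation over the (finitely many) vertices. -/
theorem exists_isEigenfunction_of_isEigenvalue (hV : V(G).Finite) (hl : l ∈ closedLengths G)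
    {k : ℝ} (hk : 0 < k) (h : (metricGraph G l hl).IsEigenvalue (k ^ 2)) :
    ∃ (φ : α → ℝ) (b : E(G) → ℝ),
      IsEigenfunction (edgeStart G) (edgeFinish G) l k φ b := by
  classical
  have : Finite E(contract G (zeroEdges G l)) := finite_contract_edgeSet _
  let inst : Fintype E(contract G (zeroEdges G l)) := Fintype.ofFinite _
  let inst' : Fintype E((metricGraph G l hl).graph) := inst
  obtain ⟨f, f', f'', ⟨hsob, ⟨Φ, hΦ⟩, hkir⟩, heq, e₀, x₀, hx₀, hne⟩ := h
  have hlpos : ∀ e : E(contract G (zeroEdges G l)), 0 < l (origEdge e) :=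
    (metricGraph G l hl).length_pos
  have hf : ∀ e : E(contract G (zeroEdges G l)), ∀ x ∈ Icc 0 (l (origEdge e)),
      f e x = Real.cos (k * x) • f e 0 + Real.sin (k * x) • (k⁻¹ • f' e 0) ∧
      f' e x = -(k * Real.sin (k * x)) • f e 0 + (k * Real.cos (k * x)) • (k⁻¹ • f' e 0) :=
    fun e x hx => (hsob e).eq_cos_add_sin (hlpos e).le hk (heq e) hx
  -- the real and the imaginary part of an eigenfunction
  have key : ∀ ρ : ℂ →ₗ[ℝ] ℝ, (∃ e : E(contract G (zeroEdges G l)),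
      ρ (f e 0) ≠ 0 ∨ ρ (k⁻¹ • f' e 0) ≠ 0) → ∃ (φ : α → ℝ) (b : E(G) → ℝ),
        IsEigenfunction (edgeStart G) (edgeFinish G) l k φ b := by
    intro ρ hρ
    let φ : α → ℝ := fun v => ρ (Φ (Quot.mk _ v))
    let b : E(G) → ℝ := fun e =>
      if h : l e = 0 then 0 else ρ (k⁻¹ • f' ⟨e.1, e.2, fun h' => h h'.2⟩ 0)
    have hb : ∀ e : E(contract G (zeroEdges G l)), b (origEdge e) = ρ (k⁻¹ • f' e 0) := fun e =>
      dif_neg (hlpos e).ne'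
    have hstart : ∀ e : E(contract G (zeroEdges G l)), φ (edgeStart G (origEdge e)) = ρ (f e 0) :=
      fun e => congrArg ρ (hΦ e).1.symm
    have hfinish : ∀ e : E(contract G (zeroEdges G l)),
        φ (edgeFinish G (origEdge e)) = ρ (f e (l (origEdge e))) :=
      fun e => congrArg ρ (hΦ e).2.symm
    have hderiv : ∀ e : E(contract G (zeroEdges G l)),
        waveDeriv k (φ (edgeStart G (origEdge e))) (b (origEdge e)) (l (origEdge e)) =
          ρ (f' e (l (origEdge e))) := fun e => by
      rw [(hf e _ ⟨(hlpos e).le, le_rfl⟩).2, hstart, hb, waveDeriv]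
      simp only [map_add, LinearMap.map_smul, smul_eq_mul]
      ring
    refine ⟨φ, b, ⟨fun e => ?_, fun ψ hψ => ?_, ?_⟩⟩
    · by_cases he : l e = 0
      · rw [he, wave_zero]
        exact congrArg (fun v => ρ (Φ v)) (mk_edgeStart_eq he)
      · obtain ⟨e, rfl⟩ : ∃ e' : E(contract G (zeroEdges G l)), origEdge e' = e :=
          ⟨⟨e.1, e.2, fun h' => he h'.2⟩, rfl⟩
        rw [hfinish, (hf e _ ⟨(hlpos e).le, le_rfl⟩).1, hstart, hb, wave]
        simp only [map_add, LinearMap.map_smul, smul_eq_mul]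
        ring
    · have h1 := sum_contract (l := l) (fun e : E(G) =>
        waveDeriv k (φ (edgeStart G e)) (b e) (l e) * ψ (edgeFinish G e) -
          k * b e * ψ (edgeStart G e)) (fun e he => by
            rw [he, waveDeriv_zero, hψ e he]; ring)
      refine h1.symm.trans ?_
      have hVf : V(contract G (zeroEdges G l)).Finite := hV.image _
      have hmemS : ∀ e : E(contract G (zeroEdges G l)),
          Quot.mk _ (edgeStart G (origEdge e)) ∈ hVf.toFinset := fun e =>
        hVf.mem_toFinset.2 ((metricGraph G l hl).isLink e).left_mem
      have hmemF : ∀ e : E(contract G (zeroEdges G l)),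
          Quot.mk _ (edgeFinish G (origEdge e)) ∈ hVf.toFinset := fun e =>
        hVf.mem_toFinset.2 ((metricGraph G l hl).isLink e).right_mem
      have h2 : ∀ v ∈ hVf.toFinset,
          ∑ e : E(contract G (zeroEdges G l)),
            ((if Quot.mk _ (edgeFinish G (origEdge e)) = v then ρ (f' e (l (origEdge e))) else 0) -
            (if Quot.mk _ (edgeStart G (origEdge e)) = v then ρ (f' e 0) else 0)) = 0 := by
        intro v hv
        have h3 := hkir v (hVf.mem_toFinset.1 hv)
        simp only [finsum_eq_if] at h3
        rw [finsum_eq_sum_of_fintype, finsum_eq_sum_of_fintype, ← Finset.sum_add_distrib] at h3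
        have h4 := congrArg (fun z => -ρ z) h3
        simp only [map_sum, map_zero, neg_zero] at h4
        rw [← Finset.sum_neg_distrib] at h4
        refine Eq.trans (Finset.sum_congr rfl fun e _ => ?_) h4
        change _ = -ρ ((if Quot.mk _ (edgeStart G (origEdge e)) = v then _ else _) +
          (if Quot.mk _ (edgeFinish G (origEdge e)) = v then _ else _))
        rw [map_add, apply_ite ρ, apply_ite ρ, map_zero, map_neg]
        split_ifs <;> simp [metricGraph, sub_eq_add_neg]
      have h5 : ∑ v ∈ hVf.toFinset, descend ψ hψ v * ∑ e : E(contract G (zeroEdges G l)),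
          ((if Quot.mk _ (edgeFinish G (origEdge e)) = v then ρ (f' e (l (origEdge e))) else 0) -
            (if Quot.mk _ (edgeStart G (origEdge e)) = v then ρ (f' e 0) else 0)) = 0 :=
        Finset.sum_eq_zero fun v hv => by rw [h2 v hv, mul_zero]
      simp only [Finset.mul_sum] at h5
      rw [Finset.sum_comm] at h5
      refine Eq.trans (Finset.sum_congr rfl fun e _ => ?_) h5
      simp only [mul_sub, mul_ite, mul_zero, Finset.sum_sub_distrib, Finset.sum_ite_eq,
        hmemS e, hmemF e, if_true]
      rw [hderiv, hb, map_smul, smul_eq_mul]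
      change _ = ψ _ * _ - ψ _ * _
      field_simp
    · obtain ⟨e, he⟩ := hρ
      refine ⟨origEdge e, hlpos e, ?_⟩
      rwa [hstart, hb]
  have hne' : f e₀ 0 ≠ 0 ∨ k⁻¹ • f' e₀ 0 ≠ 0 := by
    by_contra! hcon
    refine hne ?_
    rw [(hf e₀ x₀ hx₀).1, hcon.1, hcon.2]
    simp
  have hz : ∀ z : ℂ, z ≠ 0 → z.re ≠ 0 ∨ z.im ≠ 0 := fun z hz => by
    by_contra! hcon
    exact hz (Complex.ext hcon.1 hcon.2)
  by_cases hre : (f e₀ 0).re ≠ 0 ∨ (k⁻¹ • f' e₀ 0).re ≠ 0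
  · exact key Complex.reLm ⟨e₀, hre⟩
  · refine key Complex.imLm ⟨e₀, ?_⟩
    push Not at hre
    exact hne'.imp (fun h => (hz _ h).resolve_left (by simp [hre.1]))
      fun h => (hz _ h).resolve_left (by rw [hre.2]; simp)

end Translation

/-! ### Trees and bridges -/

section Trees

theorem eq_of_reachable {V X : Type*} {H : SimpleGraph V} {ψ : V → X}
    (hψ : ∀ x y, H.Adj x y → ψ x = ψ y) {x y : V} (h : H.Reachable x y) : ψ x = ψ y := by
  obtain ⟨p⟩ := h
  induction p with
  | nil => rfl
  | cons hadj _ ih => exact (hψ _ _ hadj).trans ih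

variable {α β : Type*} {G : Graph α β}

theorem IsConnected.endsConnected (hG : IsConnected G) :
    EndsConnected (edgeStart G) (edgeFinish G) := by
  intro φ hφ e e'
  refine eq_of_reachable (H := G.toSimpleGraph) (ψ := fun v : V(G) => φ v) (fun x y hadj => ?_)
    (hG.preconnected ⟨edgeStart G e, (ends_isLink G e).left_mem⟩
      ⟨edgeStart G e', (ends_isLink G e').left_mem⟩)
  obtain ⟨-, f, hf⟩ := (Graph.toSimpleGraph_adj ..).mp hadj
  exact eq_of_isLink hf (hφ _)

/-- The edges of a contracted graph that is a tree are bridges of the original graph. -/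
theorem exists_isCutFamily_of_isTree [Fintype E(G)] {l : E(G) → ℝ} {N : Finset E(G)}
    (hN : ∀ e, e ∈ N ↔ l e ≠ 0) (hT : IsTree (contract G (zeroEdges G l))) :
    ∃ χ, IsCutFamily (edgeStart G) (edgeFinish G) N χ := by
  classical
  obtain ⟨hsimple, hT⟩ := hT
  set T := contract G (zeroEdges G l)
  let x : E(G) → V(T) := fun e => ⟨Quot.mk _ (edgeStart G e), _, (ends_isLink G e).left_mem, rfl⟩
  let y : E(G) → V(T) := fun e => ⟨Quot.mk _ (edgeFinish G e), _, (ends_isLink G e).right_mem, rfl⟩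
  have hlink : ∀ e : E(G), l e ≠ 0 → T.IsLink e (x e) (y e) := fun e he =>
    Graph.IsLink.map _ ((Graph.deleteEdges_isLink ..).mpr ⟨ends_isLink G e, fun h => he h.2⟩)
  have hadj : ∀ e : E(G), l e ≠ 0 → T.toSimpleGraph.Adj (x e) (y e) := fun e he =>
    (Graph.toSimpleGraph_adj_iff ..).2 ⟨e, hlink e he⟩
  let H : E(G) → SimpleGraph V(T) := fun e => T.toSimpleGraph.deleteEdges {s(x e, y e)}
  let f : E(G) → Quot (contractRel G (zeroEdges G l)) → ℝ := fun e q =>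
    if ∃ h : q ∈ V(T), (H e).Reachable ⟨q, h⟩ (y e) then 1 else 0
  refine ⟨fun e v => f e (Quot.mk _ v), fun e _ v => ?_, fun e he => ?_, fun e he e' hne => ?_⟩
  · by_cases h : ∃ h : Quot.mk _ v ∈ V(T), (H e).Reachable ⟨Quot.mk _ v, h⟩ (y e)
    · exact Or.inr (if_pos h)
    · exact Or.inl (if_neg h)
  · have h1 : f e (y e) = 1 := if_pos ⟨(y e).2, SimpleGraph.Reachable.refl _⟩
    have h2 : f e (x e) = 0 := if_neg fun ⟨_, h⟩ =>
      SimpleGraph.isBridge_iff.1 (SimpleGraph.isAcyclic_iff_forall_adj_isBridge.1 hT.2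
        (hadj e ((hN e).1 he))) h
    change f e (x e) ≠ f e (y e)
    rw [h1, h2]
    exact zero_ne_one
  · by_cases hl' : l e' = 0
    · exact congrArg (f e) (mk_edgeStart_eq hl')
    · have hadj' : (H e).Adj (x e') (y e') := by
        refine SimpleGraph.deleteEdges_adj.2 ⟨hadj e' hl', fun hmem => hne ?_⟩
        have h1 := hlink e ((hN e).1 he)
        have h2 := hlink e' hl'
        rcases Sym2.eq_iff.1 (mem_singleton_iff.1 hmem) with ⟨h3, h4⟩ | ⟨h3, h4⟩
        · rw [h3, h4] at h2
          exact Subtype.ext (h2.eq h1)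
        · rw [h3, h4] at h2
          exact Subtype.ext (h2.symm.eq h1)
      refine if_congr ⟨fun ⟨_, h⟩ => ⟨(y e').2, ?_⟩, fun ⟨_, h⟩ => ⟨(x e').2, ?_⟩⟩ rfl rfl
      · exact hadj'.reachable.symm.trans h
      · exact hadj'.reachable.trans h

/-- A connected graph that is not a tree has an edge that is not a bridge. -/
theorem exists_not_bridge (hconn : IsConnected G) (hG : ¬ IsTree G) :
    ∃ e₀ : E(G), ∀ ψ : α → ℝ, (∀ e, e ≠ e₀ → ψ (edgeStart G e) = ψ (edgeFinish G e)) →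
      ψ (edgeStart G e₀) = ψ (edgeFinish G e₀) := by
  by_contra! hcon
  choose ψ hψ hne using hcon
  have hne' : ∀ {e : β} {x y : α} (h : G.IsLink e x y),
      ψ ⟨e, h.edge_mem⟩ x ≠ ψ ⟨e, h.edge_mem⟩ y := by
    intro e x y h heq
    refine hne ⟨e, h.edge_mem⟩ ?_
    rcases h.eq_and_eq_or_eq_and_eq (ends_isLink G ⟨e, h.edge_mem⟩) with ⟨h1, h2⟩ | ⟨h1, h2⟩
    · rw [edgeStart, edgeFinish, ← h1, ← h2, heq]
    · rw [edgeStart, edgeFinish, ← h1, ← h2, heq]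
  have heq : ∀ {e f : β} {x y : α} (he : e ∈ E(G)), f ≠ e → G.IsLink f x y →
      ψ ⟨e, he⟩ x = ψ ⟨e, he⟩ y := fun he hfe h =>
    eq_of_isLink h (hψ _ _ fun h' => hfe (congrArg Subtype.val h'))
  refine hG ⟨{ not_isLoopAt := fun e x h => hne' h rfl, eq_of_isLink := ?_ }, hconn, ?_⟩
  · intro e f u v he hf
    by_contra hef
    exact hne' he (heq _ (Ne.symm hef) hf)
  · refine SimpleGraph.isAcyclic_iff_forall_adj_isBridge.2 fun u v huv => ?_
    obtain ⟨-, e, he⟩ := (Graph.toSimpleGraph_adj ..).mp huv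
    refine SimpleGraph.isBridge_iff.2 fun hreach => hne' he ?_
    refine eq_of_reachable (ψ := fun w : V(G) => ψ ⟨e, he.edge_mem⟩ w) (fun x y hxy => ?_) hreach
    obtain ⟨hxy, hmem⟩ := SimpleGraph.deleteEdges_adj.1 hxy
    obtain ⟨-, f, hf⟩ := (Graph.toSimpleGraph_adj ..).mp hxy
    refine heq _ (fun hfe => hmem ?_) hf
    subst hfe
    rw [mem_singleton_iff, Sym2.eq_iff]
    rcases hf.eq_and_eq_or_eq_and_eq he with ⟨h1, h2⟩ | ⟨h1, h2⟩
    · exact Or.inl ⟨Subtype.ext h1, Subtype.ext h2⟩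
    · exact Or.inr ⟨Subtype.ext h1, Subtype.ext h2⟩

end Trees

/-! ### Supremizers -/

section SpectralGap

variable {α β : Type*} {G : Graph α β}

theorem spectralGap_le {l : E(G) → ℝ} {hl : l ∈ closedLengths G} {k : ℝ} (hk : 0 < k)
    (h : (metricGraph G l hl).IsEigenvalue (k ^ 2)) : (metricGraph G l hl).spectralGap ≤ k :=
  csInf_le ⟨0, fun _ h => h.1.le⟩ ⟨hk, h⟩

variable [Fintype E(G)] {l : E(G) → ℝ}

/-- Some positive `k` satisfies the Poincaré inequality and has `k²` as an eigenvalue. In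
particular, the infimum that defines the spectral gap is taken over a nonempty set. -/
theorem exists_poincare (hconn : IsConnected G) (hl : l ∈ closedLengths G) :
    ∃ k, 0 < k ∧ (metricGraph G l hl).IsEigenvalue (k ^ 2) ∧
      Poincare (edgeStart G) (edgeFinish G) l k := by
  have hl' := mem_closedLengths_iff.1 hl
  obtain ⟨k, φ, b, hk, h, hP⟩ :=
    exists_isEigenfunction_poincare hl'.1 hl'.2 hconn.endsConnected
  exact ⟨k, hk, h.isEigenvalue hl hk, hP⟩

/-- The spectral gap is upper semicontinuous in the edge lengths, also where edges shrink to
points. -/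
theorem eventually_spectralGap_lt (hV : V(G).Finite) (hconn : IsConnected G)
    (hl : l ∈ closedLengths G) {κ : ℝ} (hκ : (metricGraph G l hl).spectralGap < κ) :
    ∀ᶠ m in 𝓝 l, ∀ hm : m ∈ closedLengths G, (metricGraph G m hm).spectralGap < κ := by
  have hl' := mem_closedLengths_iff.1 hl
  obtain ⟨k₀, hk₀, h₀, -⟩ := exists_poincare hconn hl
  obtain ⟨k, ⟨hk, h⟩, hkκ⟩ := exists_lt_of_csInf_lt
    (s := {k : ℝ | 0 < k ∧ (metricGraph G l hl).IsEigenvalue (k ^ 2)}) ⟨k₀, hk₀, h₀⟩ hκ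
  obtain ⟨φ, b, hφ⟩ := exists_isEigenfunction_of_isEigenvalue hV hl hk h
  filter_upwards [hφ.eventually_poincare_lt hl'.1 hk hkκ] with m hmP hm
  obtain ⟨k', hk', h', hP⟩ := exists_poincare hconn hm
  exact (spectralGap_le hk' h').trans_lt (hmP k' hP)

theorem exists_isSupremizer (hV : V(G).Finite) (hconn : IsConnected G) [Nonempty E(G)] :
    ∃ (l : E(G) → ℝ) (hl : l ∈ closedLengths G), IsSupremizer G l hl := by
  classical
  have hne : (closedLengths G).Nonempty := by
    obtain ⟨e⟩ := ‹Nonempty E(G)›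
    -- all length on a single edge
    refine ⟨Pi.single e 1, mem_closedLengths_iff.2 ⟨fun e' => ?_, by simp⟩⟩
    by_cases h : e' = e
    · subst h; simp
    · simp [h]
  -- the value outside `closedLengths G` is irrelevant
  let gap : (E(G) → ℝ) → ℝ := fun l =>
    if hl : l ∈ closedLengths G then (metricGraph G l hl).spectralGap else 0
  have hgap : ∀ l (hl : l ∈ closedLengths G), gap l = (metricGraph G l hl).spectralGap :=
    fun l hl => dif_pos hl
  have husc : UpperSemicontinuousOn gap (closedLengths G) := by
    intro l hl κ hκ
    rw [hgap l hl] at hκ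
    filter_upwards [mem_nhdsWithin_of_mem_nhds (eventually_spectralGap_lt hV hconn hl hκ),
      self_mem_nhdsWithin] with m hm hm'
    rw [hgap m hm']
    exact hm hm'
  obtain ⟨l, hl, hmax⟩ := husc.exists_isMaxOn hne isCompact_closedLengths
  refine ⟨l, hl, fun m hm => ?_⟩
  rw [← hgap m hm, ← hgap l hl]
  exact hmax hm

theorem IsSupremizer.not_isTree (hV : V(G).Finite) (hconn : IsConnected G) (hG : ¬ IsTree G)
    {hl : l ∈ closedLengths G} (hsup : IsSupremizer G l hl) :
    ¬ IsTree (metricGraph G l hl).graph := by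
  classical
  intro hT
  have hl' := mem_closedLengths_iff.1 hl
  obtain ⟨χ, hχ⟩ := exists_isCutFamily_of_isTree (N := Finset.univ.filter fun e => l e ≠ 0)
    (fun e => by simp) hT
  obtain ⟨e₀, he₀⟩ := exists_not_bridge hconn hG
  obtain ⟨m, hm, hm1, c, c', hcc', hc, hc'⟩ := exists_lengths_improving hl'.1 hl'.2
    hconn.endsConnected hχ (fun e => by simp [(hl'.1 e).lt_iff_ne, eq_comm]) he₀
  have hm' : m ∈ closedLengths G := mem_closedLengths_iff.2 ⟨hm, hm1⟩
  obtain ⟨k, hk, h, hP⟩ := exists_poincare hconn hl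
  obtain ⟨k', hk', h', -⟩ := exists_poincare hconn hm'
  have h1 : c' ≤ (metricGraph G m hm').spectralGap := by
    refine le_csInf ⟨k', hk', h'⟩ fun κ hκ => ?_
    obtain ⟨φ, b, hφ⟩ := exists_isEigenfunction_of_isEigenvalue hV hm' hκ.1 hκ.2
    exact hc' κ φ b hκ.1 hφ
  have h2 := hsup m hm'
  have h3 := (spectralGap_le hk h).trans (hc k hP)
  linarith

end SpectralGap

end QuantumGraph

theorem corollary2p3 {α β : Type*} (G : Graph α β) (hV : V(G).Finite) (hE : E(G).Finite)
    (hconn : QuantumGraph.IsConnected G) (hG : ¬ QuantumGraph.IsTree G) :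
    (∃ (l : E(G) → ℝ) (hl : l ∈ QuantumGraph.closedLengths G),
      QuantumGraph.IsSupremizer G l hl) ∧
    ∀ (l : E(G) → ℝ) (hl : l ∈ QuantumGraph.closedLengths G),
      QuantumGraph.IsSupremizer G l hl →
        ¬ QuantumGraph.IsTree (QuantumGraph.metricGraph G l hl).graph := by
  have := hE.fintype
  have : Nonempty E(G) := ⟨(QuantumGraph.exists_not_bridge hconn hG).choose⟩
  exact ⟨QuantumGraph.exists_isSupremizer hV hconn, fun l hl h => h.not_isTree hV hconn hG⟩
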